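/- Let $n\ge 1$ and $a=(a_1,\dots,a_n)$ with all $a_i>0$. A parallelepiped is a set of the form $E(x,t)=\{y\in\mathbb R^n: |y_i-x_i|\le t^{a_i},\ i=1,\dots,n\}$ with $x\in\mathbb R^n$, $t>0$. A weight is a locally integrable function $w$ on $\mathbb R^n$ with values in $(0,\infty)$ almost everywhere, and $w(S)=\int_S w(x)\,dx$. The anisotropic maximal function of $f$ is $$Mf(x)=\sup_{t>0}\frac1{|E(x,t)|}\int_{E(x,t)}|f(y)|\,dy .$$ For $1\le p<\infty$ and $0\le\kappa<1$, the weighted anisotropic Morrey space $L_{p,\kappa,a}(w)$ consists of the functions $f$ that are locally integrable with respect to $w(x)\,dx$ and satisfy $$\|f\|_{L_{p,\kappa,a}(w)}=\sup_{E}\Big(\frac1{w(E)^{\kappa}}\int_E|f(x)|^p w(x)\,dx\Big)^{1/p}<\infty ,$$ where the supremum is over all parallelepipeds $E$. For $1<p<\infty$, a weight $w$ belongs to $A_p$ if there is a constant $C>1$ with $$\Big(\frac1{|E|}\int_E w(x)\,dx\Big)\Big(\frac1{|E|}\int_E w(x)^{1-p'}dx\Big)^{p-1}\le C$$ for all parallelepipeds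 $E$, where $\frac1p+\frac1{p'}=1$; and $w\in A_1$ if there is a constant $C>1$ with $Mw(x)\le C\,w(x)$ for almost every $x$. Theorem. Let $0<\kappa<1$. (1) If $1<p<\infty$ and $w\in A_p$, then $M$ is bounded on $L_{p,\kappa,a}(w)$: there is a constant $C>0$, independent of $f$, such that for every $f\in L_{p,\kappa,a}(w)$ one has $Mf\in L_{p,\kappa,a}(w)$ and $\|Mf\|_{L_{p,\kappa,a}(w)}\le C\|f\|_{L_{p,\kappa,a}(w)}$. (2) If $w\in A_1$, then there is a constant $C>0$ such that for every $f\in L_{1,\kappa,a}(w)$, every parallelepiped $E$ and every $t>0$, $$w(\{x\in E: Mf(x)>t\})\le \frac{C}{t}\,\|f\|_{L_{1,\kappa,a}(w)}\,w(E)^{\kappa}.$$ -/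

import Mathlib

open MeasureTheory
open scoped ENNReal

/-- The one-parametric parallelepiped `E(x, t) = {y : |y_i - x_i| ≤ t ^ a_i, i = 1, …, n}`.
The space `ℝⁿ` is modelled by `Fin n → ℝ`; only its topology and its Lebesgue measure matter. -/
def parallelepiped_a {n : ℕ} (a : Fin n → ℝ) (x : Fin n → ℝ) (t : ℝ) : Set (Fin n → ℝ) :=
  {y | ∀ i, |y i - x i| ≤ t ^ a i}

/-- A weight: a locally integrable function with values in `(0, ∞)` almost everywhere. -/
def IsWeight {n : ℕ} (w : (Fin n → ℝ) → ℝ) : Prop :=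
  LocallyIntegrable w volume ∧ ∀ᵐ x ∂(volume : Measure (Fin n → ℝ)), 0 < w x

/-- The measure `w(x) dx`, so that `weightMeasure w S` is `w(S) = ∫_S w(x) dx`. -/
noncomputable def weightMeasure {n : ℕ} (w : (Fin n → ℝ) → ℝ) : Measure (Fin n → ℝ) :=
  volume.withDensity (fun x => ENNReal.ofReal (w x))

/-- The anisotropic (centred) maximal function
`Mf(x) = sup_{t > 0} |E(x,t)|⁻¹ ∫_{E(x,t)} |f(y)| dy`, with values in `[0, ∞]`. -/
noncomputable def anisoMaximal {n : ℕ} {β : Type*} [ENorm β] (a : Fin n → ℝ)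
    (f : (Fin n → ℝ) → β) (x : Fin n → ℝ) : ℝ≥0∞ :=
  ⨆ (t : ℝ) (_ : 0 < t),
    (volume (parallelepiped_a a x t))⁻¹ * ∫⁻ y in parallelepiped_a a x t, ‖f y‖ₑ

/-- The norm of the weighted anisotropic Morrey space `L_{p,κ,a}(w)`,
`sup_E (w(E)^{-κ} ∫_E |f(x)|^p w(x) dx)^{1/p}`, with values in `[0, ∞]`. -/
noncomputable def morreyNorm {n : ℕ} {β : Type*} [ENorm β] (a : Fin n → ℝ) (p κ : ℝ)
    (w : (Fin n → ℝ) → ℝ) (f : (Fin n → ℝ) → β) : ℝ≥0∞ :=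
  ⨆ (x : Fin n → ℝ) (t : ℝ) (_ : 0 < t),
    ((weightMeasure w (parallelepiped_a a x t) ^ κ)⁻¹ *
      ∫⁻ y in parallelepiped_a a x t, ‖f y‖ₑ ^ p ∂(weightMeasure w)) ^ (1 / p)

/-- Membership in `L_{p,κ,a}(w)`: the function is locally integrable with respect to `w(x) dx`
(which includes measurability) and its Morrey norm is finite. The values may lie in `ℝ`, in `ℂ`
or, as for a maximal function, in `[0, ∞]`; in the last case membership entails finiteness
almost everywhere. -/
def MemMorrey {n : ℕ} {β : Type*} [TopologicalSpace β] [ContinuousENorm β] (a : Fin n → ℝ)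
    (p κ : ℝ) (w : (Fin n → ℝ) → ℝ) (f : (Fin n → ℝ) → β) : Prop :=
  LocallyIntegrable f (weightMeasure w) ∧ morreyNorm a p κ w f < ∞

/-- The Muckenhoupt class `A_p`, `1 < p < ∞`, relative to the parallelepipeds `E(x, t)`; here
`Real.conjExponent p = p / (p - 1)` is `p'`. -/
def MuckenhouptAp {n : ℕ} (a : Fin n → ℝ) (p : ℝ) (w : (Fin n → ℝ) → ℝ) : Prop :=
  IsWeight w ∧ ∃ C : ℝ, 1 < C ∧ ∀ (x : Fin n → ℝ) (t : ℝ), 0 < t →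
    ((volume (parallelepiped_a a x t))⁻¹ *
        ∫⁻ y in parallelepiped_a a x t, ENNReal.ofReal (w y)) *
      ((volume (parallelepiped_a a x t))⁻¹ *
        ∫⁻ y in parallelepiped_a a x t,
          ENNReal.ofReal (w y) ^ (1 - Real.conjExponent p)) ^ (p - 1) ≤ ENNReal.ofReal C

/-- The Muckenhoupt class `A_1`: `Mw ≤ C w` almost everywhere. -/
def MuckenhouptA1 {n : ℕ} (a : Fin n → ℝ) (w : (Fin n → ℝ) → ℝ) : Prop :=
  IsWeight w ∧ ∃ C : ℝ, 1 < C ∧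
    ∀ᵐ x ∂(volume : Measure (Fin n → ℝ)), anisoMaximal a w x ≤ ENNReal.ofReal (C * w x)

/-! ### Geometry of anisotropic boxes. -/

section Geometry

variable {n : ℕ} {a : Fin n → ℝ}

/-! The geometric input is `exists_engulfing`: a box that meets another one of comparable or larger
radius lies in a fixed dilate of it. Vitali's covering argument then gives, for every measure `μ`
doubling on boxes, the weak type (1,1) of the maximal operator `M_μ` with `μ`-averages, and
truncation upgrades this to strong type (q,q) for q > 1.

Both `A_p` and `A_1` are used through `AverageBound`: Lebesgue averages are at most a constant times
L^p averages relative to w dx. Testing on indicators shows that w dx is doubling; for p > 1 the same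
holds for the dual weight σ = w^{1-p'}. Lerner's pointwise bound (Mf)^{p-1} ≤ C
M_w((M_σ(f/σ))^{p-1}/w), followed by the L^{p'}(w) bound for M_w and the L^p(σ) bound for M_σ,
yields Muckenhoupt's theorem with no reverse Hölder inequality.

For the Morrey estimate fix E = E(x₀,r) and a point x of E. Averages around x of radius at most r
see only f on a dilate of E, where the weighted estimate and doubling apply. Larger averages are
compared with boxes centred at x₀; there `AverageBound` and the Morrey norm give C
w(E)^{(κ-1)/p}‖f‖, since κ - 1 ≤ 0 makes the smallest box the worst. Taking p-th powers and
integrating over E restores w(E)^κ. In the `A_1` case `AverageBound` at p = 1 says Mg ≤ M_w(Ag) for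
a constant A, so the weak type of M_w replaces Muckenhoupt's theorem. -/

theorem parallelepiped_a_eq_Icc (a x : Fin n → ℝ) (t : ℝ) :
    parallelepiped_a a x t = Set.Icc (fun i => x i - t ^ a i) (fun i => x i + t ^ a i) := by
  ext y
  simp only [parallelepiped_a, Set.mem_ofPred_eq, Set.mem_Icc, Pi.le_def, ← forall_and, abs_le]
  exact forall_congr' fun i => ⟨fun h => ⟨by linarith, by linarith⟩,
    fun h => ⟨by linarith, by linarith⟩⟩

theorem isCompact_parallelepiped_a (a x : Fin n → ℝ) (t : ℝ) :
    IsCompact (parallelepiped_a a x t) := by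
  rw [parallelepiped_a_eq_Icc]; exact isCompact_Icc

theorem measurableSet_parallelepiped_a (a x : Fin n → ℝ) (t : ℝ) :
    MeasurableSet (parallelepiped_a a x t) :=
  (isCompact_parallelepiped_a a x t).measurableSet

theorem parallelepiped_a_mem_nhds (a x : Fin n → ℝ) {t : ℝ} (ht : 0 < t) :
    parallelepiped_a a x t ∈ nhds x := by
  rw [parallelepiped_a_eq_Icc]
  refine pi_Icc_mem_nhds (fun i => ?_) (fun i => ?_) <;>
    · have := Real.rpow_pos_of_pos ht (a i)
      linarith

theorem mem_parallelepiped_a_self (a x : Fin n → ℝ) {t : ℝ} (ht : 0 < t) :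
    x ∈ parallelepiped_a a x t := mem_of_mem_nhds (parallelepiped_a_mem_nhds a x ht)

theorem mem_parallelepiped_a_comm {x y : Fin n → ℝ} {t : ℝ} :
    y ∈ parallelepiped_a a x t ↔ x ∈ parallelepiped_a a y t := by
  simp only [parallelepiped_a, Set.mem_ofPred_eq, abs_sub_comm]

theorem parallelepiped_a_mono (ha : ∀ i, 0 < a i) (x : Fin n → ℝ) {s t : ℝ} (hs : 0 ≤ s)
    (hst : s ≤ t) : parallelepiped_a a x s ⊆ parallelepiped_a a x t :=
  fun _ hy i => (hy i).trans (Real.rpow_le_rpow hs hst (ha i).le)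

theorem volume_parallelepiped_a (a x : Fin n → ℝ) (t : ℝ) :
    volume (parallelepiped_a a x t) = ∏ i, ENNReal.ofReal (2 * t ^ a i) := by
  rw [parallelepiped_a_eq_Icc, Real.volume_Icc_pi]
  exact Finset.prod_congr rfl fun i _ => by ring_nf

theorem volume_parallelepiped_a_mul (a x y : Fin n → ℝ) {K t : ℝ} (hK : 0 < K) (ht : 0 < t) :
    volume (parallelepiped_a a x (K * t)) =
      (∏ i, ENNReal.ofReal (K ^ a i)) * volume (parallelepiped_a a y t) := by
  rw [volume_parallelepiped_a, volume_parallelepiped_a, ← Finset.prod_mul_distrib]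
  refine Finset.prod_congr rfl fun i _ => ?_
  rw [← ENNReal.ofReal_mul (Real.rpow_nonneg hK.le _), Real.mul_rpow hK.le ht.le]
  ring_nf

theorem prod_ofReal_ne_top {ι : Type*} [Fintype ι] (f : ι → ℝ) :
    ∏ i, ENNReal.ofReal (f i) ≠ ∞ :=
  ENNReal.prod_ne_top fun _ _ => ENNReal.ofReal_ne_top

/-- Coordinatewise triangle inequality: |v - x| ≤ 2 s^{a_i} + t^{a_i} for v in the second box. The
slack s ≤ 2t is what the Vitali selection provides, where radii are comparable only up to a factor
2. -/
theorem exists_engulfing (ha : ∀ i, 0 < a i) :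
    ∃ K : ℝ, 1 ≤ K ∧ ∀ (x y : Fin n → ℝ) (s t : ℝ), 0 < s → s ≤ 2 * t →
      (parallelepiped_a a x t ∩ parallelepiped_a a y s).Nonempty →
      parallelepiped_a a y s ⊆ parallelepiped_a a x (K * t) := by
  -- One K serves all coordinates because every exponent is positive and there are finitely many.
  have h : ∀ᶠ K : ℝ in Filter.atTop, ∀ i, 1 + 2 * 2 ^ a i ≤ K ^ a i :=
    Filter.eventually_all.2 fun i => (tendsto_rpow_atTop (ha i)).eventually_ge_atTop _
  obtain ⟨K, hK, hK1⟩ := (h.and (Filter.eventually_ge_atTop 1)).exists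
  refine ⟨K, hK1, fun x y s t hs hst => ?_⟩
  rintro ⟨z, hzx, hzy⟩ v hv i
  have ht : 0 < t := by linarith
  have hsa : s ^ a i ≤ 2 ^ a i * t ^ a i := by
    rw [← Real.mul_rpow (by norm_num) ht.le]
    exact Real.rpow_le_rpow hs.le hst (ha i).le
  have h1 : |v i - x i| ≤ |v i - y i| + |z i - y i| + |z i - x i| := by
    calc |v i - x i| = |(v i - y i) - (z i - y i) + (z i - x i)| := by ring_nf
      _ ≤ |(v i - y i) - (z i - y i)| + |z i - x i| := abs_add_le _ _
      _ ≤ _ := by gcongr; exact abs_sub _ _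
  have h2 := hv i
  have h3 := hzy i
  have h4 := hzx i
  have h5 := mul_le_mul_of_nonneg_right (hK i) (Real.rpow_nonneg ht.le (a i))
  rw [Real.mul_rpow (by linarith) ht.le]
  linarith

end Geometry

/-! ### Maximal operators of doubling measures. -/

section MaximalOperator

variable {n : ℕ} {a : Fin n → ℝ} {μ : Measure (Fin n → ℝ)}

/-- The centred maximal operator over parallelepipeds with averages taken relative to `μ`. -/
noncomputable def maximalOperator (a : Fin n → ℝ) (μ : Measure (Fin n → ℝ))
    (g : (Fin n → ℝ) → ℝ≥0∞) (x : Fin n → ℝ) : ℝ≥0∞ :=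
  ⨆ (t : ℝ) (_ : 0 < t),
    (μ (parallelepiped_a a x t))⁻¹ * ∫⁻ y in parallelepiped_a a x t, g y ∂μ

/-- Measures that are positive, finite and doubling on parallelepipeds. -/
structure IsDoublingOnParallelepipeds (a : Fin n → ℝ) (μ : Measure (Fin n → ℝ)) : Prop where
  ne_zero : ∀ x t, 0 < t → μ (parallelepiped_a a x t) ≠ 0
  ne_top : ∀ x t, 0 < t → μ (parallelepiped_a a x t) ≠ ∞
  doubling : ∀ K : ℝ, 1 ≤ K → ∃ D : ℝ≥0∞, D ≠ ∞ ∧ ∀ x t, 0 < t →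
    μ (parallelepiped_a a x (K * t)) ≤ D * μ (parallelepiped_a a x t)

theorem isDoublingOnParallelepipeds_volume (a : Fin n → ℝ) :
    IsDoublingOnParallelepipeds a volume where
  ne_zero x _ ht := (Measure.measure_pos_of_mem_nhds _ (parallelepiped_a_mem_nhds a x ht)).ne'
  ne_top x t _ := (isCompact_parallelepiped_a a x t).measure_lt_top.ne
  doubling K hK := ⟨_, prod_ofReal_ne_top _, fun x _ ht =>
    (volume_parallelepiped_a_mul a x x (by linarith) ht).le⟩

theorem average_le_maximalOperator (g : (Fin n → ℝ) → ℝ≥0∞) (x : Fin n → ℝ) {t : ℝ}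
    (ht : 0 < t) :
    (μ (parallelepiped_a a x t))⁻¹ * ∫⁻ y in parallelepiped_a a x t, g y ∂μ ≤
      maximalOperator a μ g x :=
  le_iSup₂ (f := fun (t : ℝ) (_ : 0 < t) =>
    (μ (parallelepiped_a a x t))⁻¹ * ∫⁻ y in parallelepiped_a a x t, g y ∂μ) t ht

theorem maximalOperator_congr_ae {g h : (Fin n → ℝ) → ℝ≥0∞} (hgh : g =ᵐ[μ] h) :
    maximalOperator a μ g = maximalOperator a μ h := by
  ext x
  unfold maximalOperator
  congr! 4 with t ht
  exact lintegral_congr_ae (ae_restrict_of_ae hgh)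

theorem IsDoublingOnParallelepipeds.average_const_le (hμ : IsDoublingOnParallelepipeds a μ)
    (x : Fin n → ℝ) {t : ℝ} (ht : 0 < t) (c : ℝ≥0∞) :
    (μ (parallelepiped_a a x t))⁻¹ * ∫⁻ _ in parallelepiped_a a x t, c ∂μ = c := by
  rw [setLIntegral_const, mul_comm c, ← mul_assoc,
    ENNReal.inv_mul_cancel (hμ.ne_zero x t ht) (hμ.ne_top x t ht), one_mul]

theorem iInter_parallelepiped_a (a x : Fin n → ℝ) (ha : ∀ i, 0 < a i) {t : ℝ} {s : ℕ → ℝ}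
    (hs : Filter.Tendsto s Filter.atTop (nhds t)) (hts : ∀ k, t < s k) (ht : 0 < t) :
    ⋂ k, parallelepiped_a a x (s k) = parallelepiped_a a x t := by
  refine Set.Subset.antisymm (fun y hy i => ?_) (Set.subset_iInter fun k =>
    parallelepiped_a_mono ha x ht.le (hts k).le)
  exact ge_of_tendsto' (hs.rpow_const (Or.inl ht.ne')) fun k => Set.mem_iInter.1 hy k i

/-- Averages are not monotone in t, but approaching t from above can only enlarge the integral,
while the measure of the box is continuous from above. A countable supremum is what measurability
needs. -/
theorem maximalOperator_eq_iSup_rat (ha : ∀ i, 0 < a i) (hμ : IsDoublingOnParallelepipeds a μ)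
    (g : (Fin n → ℝ) → ℝ≥0∞) (x : Fin n → ℝ) :
    maximalOperator a μ g x = ⨆ (t : ℚ) (_ : 0 < t),
      (μ (parallelepiped_a a x t))⁻¹ * ∫⁻ y in parallelepiped_a a x t, g y ∂μ := by
  apply le_antisymm
  · refine iSup₂_le fun t ht => ?_
    obtain ⟨s, hs_anti, hs, hlim⟩ := exists_seq_strictAnti_tendsto t
    have hq : ∀ k, ∃ q : ℚ, t < q ∧ (q : ℝ) < s k := fun k => exists_rat_btwn (hs k)
    choose q hq1 hq2 using hq
    have hqlim : Filter.Tendsto (fun k => (q k : ℝ)) Filter.atTop (nhds t) :=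
      tendsto_of_tendsto_of_tendsto_of_le_of_le tendsto_const_nhds hlim
        (fun k => (hq1 k).le) (fun k => (hq2 k).le)
    have hμlim : Filter.Tendsto (fun k => μ (parallelepiped_a a x (s k))) Filter.atTop
        (nhds (μ (parallelepiped_a a x t))) := by
      rw [← iInter_parallelepiped_a a x ha hlim hs ht]
      refine tendsto_measure_iInter_atTop
        (fun k => (measurableSet_parallelepiped_a a x _).nullMeasurableSet) ?_
        ⟨0, hμ.ne_top x _ (ht.trans (hs 0))⟩
      exact fun i j hij => parallelepiped_a_mono ha x (ht.trans (hs j)).le (hs_anti.antitone hij)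
    have hμlim' : Filter.Tendsto (fun k => μ (parallelepiped_a a x (q k))) Filter.atTop
        (nhds (μ (parallelepiped_a a x t))) :=
      tendsto_of_tendsto_of_tendsto_of_le_of_le tendsto_const_nhds hμlim
        (fun k => measure_mono (parallelepiped_a_mono ha x ht.le (hq1 k).le))
        (fun k => measure_mono (parallelepiped_a_mono ha x (ht.trans (hq1 k)).le (hq2 k).le))
    have hlim2 := ENNReal.Tendsto.mul_const (b := ∫⁻ y in parallelepiped_a a x t, g y ∂μ)
      (tendsto_inv_iff.2 hμlim')
      (Or.inl (ENNReal.inv_ne_zero.2 (hμ.ne_top x t ht)))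
    refine le_of_tendsto' hlim2 fun k => ?_
    have hk : (0 : ℚ) < q k := by exact_mod_cast ht.trans (hq1 k)
    refine le_trans ?_ (le_iSup₂ (f := fun (t : ℚ) (_ : 0 < t) => (μ (parallelepiped_a a x t))⁻¹ *
      ∫⁻ y in parallelepiped_a a x t, g y ∂μ) (q k) hk)
    gcongr
    exact parallelepiped_a_mono ha x ht.le (hq1 k).le
  · exact iSup₂_le fun t ht => average_le_maximalOperator g x (by exact_mod_cast ht)

theorem measurable_maximalOperator [SFinite μ] (ha : ∀ i, 0 < a i)
    (hμ : IsDoublingOnParallelepipeds a μ) {g : (Fin n → ℝ) → ℝ≥0∞} (hg : AEMeasurable g μ) :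
    Measurable (maximalOperator a μ g) := by
  rw [maximalOperator_congr_ae hg.ae_eq_mk]
  -- The moving domain becomes an indicator on the product space, so Tonelli gives measurability in
  -- the centre; h = 1 covers the measure of the box.
  have key : ∀ h : (Fin n → ℝ) → ℝ≥0∞, Measurable h → ∀ t : ℝ,
      Measurable fun x => ∫⁻ y in parallelepiped_a a x t, h y ∂μ := by
    intro h hh t
    have hS : MeasurableSet {z : (Fin n → ℝ) × (Fin n → ℝ) | z.2 ∈ parallelepiped_a a z.1 t} := by
      have : {z : (Fin n → ℝ) × (Fin n → ℝ) | z.2 ∈ parallelepiped_a a z.1 t} =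
          ⋂ i, {z | |z.2 i - z.1 i| ≤ t ^ a i} := by
        ext z; simp [parallelepiped_a]
      rw [this]
      exact MeasurableSet.iInter fun i => measurableSet_le (by fun_prop) (by fun_prop)
    have hm : Measurable fun z : (Fin n → ℝ) × (Fin n → ℝ) =>
        Set.indicator {z : (Fin n → ℝ) × (Fin n → ℝ) | z.2 ∈ parallelepiped_a a z.1 t}
          (fun z => h z.2) z := (hh.comp measurable_snd).indicator hS
    convert hm.lintegral_prod_right' (ν := μ) using 2 with x
    rw [← lintegral_indicator (measurableSet_parallelepiped_a a x t)]
    rfl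
  have heq : maximalOperator a μ (hg.mk g) = fun x => ⨆ (t : ℚ) (_ : 0 < t),
      (μ (parallelepiped_a a x t))⁻¹ * ∫⁻ y in parallelepiped_a a x t, hg.mk g y ∂μ :=
    funext fun x => maximalOperator_eq_iSup_rat ha hμ _ x
  rw [heq]
  refine Measurable.iSup fun t => Measurable.iSup fun _ => ?_
  refine Measurable.mul (Measurable.inv ?_) (key _ hg.measurable_mk t)
  simpa using key (fun _ => 1) measurable_const t

/-- The weak type `(1, 1)` inequality. -/
theorem IsDoublingOnParallelepipeds.weak_type (ha : ∀ i, 0 < a i)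
    (hμ : IsDoublingOnParallelepipeds a μ) :
    ∃ D : ℝ≥0∞, D ≠ ∞ ∧ ∀ (g : (Fin n → ℝ) → ℝ≥0∞) (c : ℝ≥0∞),
      c * μ {x | c < maximalOperator a μ g x} ≤ D * ∫⁻ x, g x ∂μ := by
  obtain ⟨K, hK1, hK⟩ := exists_engulfing ha
  obtain ⟨D, hD, hdoub⟩ := hμ.doubling K hK1
  refine ⟨D, hD, fun g c => ?_⟩
  -- Vitali selection needs bounded radii, so the level set is exhausted by those points where some
  -- radius at most R already works.
  let A : ℕ → Set (Fin n → ℝ) := fun R => {x | ∃ t : ℝ, 0 < t ∧ t ≤ R ∧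
    c < (μ (parallelepiped_a a x t))⁻¹ * ∫⁻ y in parallelepiped_a a x t, g y ∂μ}
  have hA : {x | c < maximalOperator a μ g x} = ⋃ R, A R := by
    ext x
    simp only [maximalOperator, lt_iSup_iff, Set.mem_ofPred_eq, Set.mem_iUnion, A]
    constructor
    · rintro ⟨t, ht, h⟩
      obtain ⟨R, hR⟩ := exists_nat_ge t
      exact ⟨R, t, ht, hR, h⟩
    · rintro ⟨R, t, ht, -, h⟩
      exact ⟨t, ht, h⟩
  have hAmono : Monotone A := fun R S hRS x ⟨t, ht, htR, h⟩ =>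
    ⟨t, ht, htR.trans (by exact_mod_cast hRS), h⟩
  rw [hA, hAmono.measure_iUnion, ENNReal.mul_iSup]
  refine iSup_le fun R => ?_
  choose! r hr0 hrR hr using fun x (hx : x ∈ A R) => hx
  obtain ⟨u, huA, hdisj, hcov⟩ := Vitali.exists_disjoint_subfamily_covering_enlargement
    (fun x => parallelepiped_a a x (r x)) (A R) r 2 (by norm_num) (fun x hx => (hr0 x hx).le) R
    hrR (fun x hx => ⟨x, mem_parallelepiped_a_self a x (hr0 x hx)⟩)
  have hucount : u.Countable := hdisj.countable_of_nonempty_interior fun x hx =>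
    ⟨x, mem_interior_iff_mem_nhds.2 (parallelepiped_a_mem_nhds a x (hr0 x (huA hx)))⟩
  have hsub : A R ⊆ ⋃ x ∈ u, parallelepiped_a a x (K * r x) := by
    intro x hx
    obtain ⟨b, hb, hne, hle⟩ := hcov x hx
    refine Set.mem_biUnion hb (hK b x (r x) (r b) (hr0 x hx) hle ?_
      (mem_parallelepiped_a_self a x (hr0 x hx)))
    rwa [Set.inter_comm]
  calc c * μ (A R) ≤ c * ∑' x : u, μ (parallelepiped_a a x (K * r x)) := by
        gcongr
        exact (measure_mono hsub).trans (measure_biUnion_le μ hucount _)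
    _ ≤ ∑' x : u, D * ∫⁻ y in parallelepiped_a a x (r x), g y ∂μ := by
        rw [← ENNReal.tsum_mul_left]
        refine ENNReal.tsum_le_tsum fun x => ?_
        have hx := huA x.2
        have h0 := hμ.ne_zero x _ (hr0 x hx)
        have h1 := hμ.ne_top x _ (hr0 x hx)
        calc c * μ (parallelepiped_a a x (K * r x))
            ≤ ((μ (parallelepiped_a a x (r x)))⁻¹ * ∫⁻ y in parallelepiped_a a x (r x), g y ∂μ) *
              (D * μ (parallelepiped_a a x (r x))) :=
                mul_le_mul' (hr x hx).le (hdoub x _ (hr0 x hx))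
          _ = ((μ (parallelepiped_a a x (r x)))⁻¹ * μ (parallelepiped_a a x (r x))) *
              (D * ∫⁻ y in parallelepiped_a a x (r x), g y ∂μ) := by ring
          _ = _ := by rw [ENNReal.inv_mul_cancel h0 h1, one_mul]
    _ = D * ∫⁻ y in ⋃ x ∈ u, parallelepiped_a a x (r x), g y ∂μ := by
        rw [ENNReal.tsum_mul_left, lintegral_biUnion hucount
          (fun x _ => measurableSet_parallelepiped_a a x _) hdisj]
    _ ≤ D * ∫⁻ y, g y ∂μ := by
        gcongr
        exact Measure.restrict_le_self

/-- The layer-cake formula ∫₀^h s^{r-1} ds = h^r / r, including h = ∞, in a form suited to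
exchanging integrals over level sets. -/
theorem lintegral_rpow_sub_one_lt {r : ℝ} (hr : 0 < r) (h : ℝ≥0∞) :
    ∫⁻ s in Set.Ioi (0 : ℝ), (if ENNReal.ofReal s < h then ENNReal.ofReal (s ^ (r - 1)) else 0) =
      (ENNReal.ofReal r)⁻¹ * h ^ r := by
  have fin : ∀ b : ℝ, 0 ≤ b → ∫⁻ s in Set.Ioi (0 : ℝ),
      (if ENNReal.ofReal s < ENNReal.ofReal b then ENNReal.ofReal (s ^ (r - 1)) else 0) =
      (ENNReal.ofReal r)⁻¹ * ENNReal.ofReal b ^ r := by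
    intro b hb
    have h1 : ∀ s ∈ Set.Ioi (0 : ℝ),
        (if ENNReal.ofReal s < ENNReal.ofReal b then ENNReal.ofReal (s ^ (r - 1)) else 0) =
        (Set.Iio b).indicator (fun s => ENNReal.ofReal (s ^ (r - 1))) s := by
      intro s hs
      rw [Set.indicator_apply]
      congr 1
      rw [ENNReal.ofReal_lt_ofReal_iff_of_nonneg (le_of_lt hs)]
      rfl
    rw [setLIntegral_congr_fun measurableSet_Ioi h1, setLIntegral_indicator measurableSet_Iio,
      Set.Iio_inter_Ioi, setLIntegral_congr Ioo_ae_eq_Ioc]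
    have hint : IntervalIntegrable (fun s : ℝ => s ^ (r - 1)) volume 0 b :=
      intervalIntegral.intervalIntegrable_rpow' (by linarith)
    rw [← ofReal_integral_eq_lintegral_ofReal
      ((intervalIntegrable_iff_integrableOn_Ioc_of_le hb).1 hint)
      ((ae_restrict_iff' measurableSet_Ioc).2 (.of_forall fun s hs =>
        Real.rpow_nonneg hs.1.le _)), ← intervalIntegral.integral_of_le hb,
      integral_rpow (Or.inl (by linarith)), sub_add_cancel, Real.zero_rpow hr.ne', sub_zero,
      ENNReal.ofReal_div_of_pos hr, ENNReal.ofReal_rpow_of_nonneg hb hr.le, div_eq_mul_inv,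
      mul_comm]
  rcases eq_or_ne h ∞ with rfl | hh
  · rw [ENNReal.top_rpow_of_pos hr, ENNReal.mul_top (by simp)]
    have hlim : Filter.Tendsto (fun k : ℕ => (ENNReal.ofReal r)⁻¹ * ENNReal.ofReal k ^ r)
        Filter.atTop (nhds ∞) := by
      have h2 : Filter.Tendsto (fun k : ℕ => ENNReal.ofReal k ^ r) Filter.atTop (nhds ∞) := by
        have := (ENNReal.continuous_rpow_const (y := r)).tendsto ∞
        rw [ENNReal.top_rpow_of_pos hr] at this
        refine this.comp ?_
        simpa using ENNReal.tendsto_nat_nhds_top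
      have := ENNReal.Tendsto.const_mul (a := (ENNReal.ofReal r)⁻¹) h2 (Or.inl ENNReal.top_ne_zero)
      rwa [ENNReal.mul_top (by simp)] at this
    refine top_le_iff.1 (le_of_tendsto' hlim fun k => ?_)
    rw [← fin k (Nat.cast_nonneg k)]
    refine lintegral_mono fun s => ?_
    simp only [ENNReal.ofReal_lt_top, if_true]
    split_ifs <;> simp
  · rw [← ENNReal.ofReal_toReal hh]
    exact fin _ ENNReal.toReal_nonneg

/-- The strong type `(q, q)` inequality for `q > 1`. -/
theorem IsDoublingOnParallelepipeds.strong_type [SFinite μ] (ha : ∀ i, 0 < a i)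
    (hμ : IsDoublingOnParallelepipeds a μ) {q : ℝ} (hq : 1 < q) :
    ∃ C : ℝ≥0∞, C ≠ ∞ ∧ ∀ g : (Fin n → ℝ) → ℝ≥0∞, AEMeasurable g μ →
      ∫⁻ x, maximalOperator a μ g x ^ q ∂μ ≤ C * ∫⁻ x, g x ^ q ∂μ := by
  obtain ⟨D, hD, hweak⟩ := hμ.weak_type ha
  have hq0 : 0 < q := by linarith
  have hq1 : 0 < q - 1 := by linarith
  have hqi : (ENNReal.ofReal (q - 1))⁻¹ ≠ ∞ := by simpa using hq
  have h2q : (2 : ℝ≥0∞) ^ (q - 1) ≠ ∞ := ENNReal.rpow_ne_top_of_nonneg hq1.le (by simp)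
  refine ⟨ENNReal.ofReal q * (2 * D * ((ENNReal.ofReal (q - 1))⁻¹ * 2 ^ (q - 1))), by finiteness,
    ?_⟩
  suffices H : ∀ g : (Fin n → ℝ) → ℝ≥0∞, Measurable g →
      ∫⁻ x, maximalOperator a μ g x ^ q ∂μ ≤
        ENNReal.ofReal q * (2 * D * ((ENNReal.ofReal (q - 1))⁻¹ * 2 ^ (q - 1))) *
          ∫⁻ x, g x ^ q ∂μ by
    intro g hg
    rw [maximalOperator_congr_ae hg.ae_eq_mk]
    refine (H _ hg.measurable_mk).trans_eq ?_
    congr 1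
    exact lintegral_congr_ae (hg.ae_eq_mk.symm.fun_comp (· ^ q))
  intro g hg
  have hMm := measurable_maximalOperator ha hμ hg.aemeasurable
  have hlevel : ∀ s : ℝ, 0 < s → ENNReal.ofReal s * μ {x | ENNReal.ofReal s < maximalOperator a μ g x}
      ≤ 2 * D * ∫⁻ x, (if ENNReal.ofReal s < 2 * g x then g x else 0) ∂μ := by
    intro s hs
    -- Cut g at height c = s/2. The low part raises every average by at most c, so Mg > s forces Mg'
    -- > s/2 for the high part g', to which the weak type applies.
    set c := ENNReal.ofReal (s / 2) with hc
    have hsc : ENNReal.ofReal s = 2 * c := by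
      rw [hc, ← ENNReal.ofReal_ofNat 2, ← ENNReal.ofReal_mul (by norm_num)]; ring_nf
    set g' : (Fin n → ℝ) → ℝ≥0∞ := fun x => if ENNReal.ofReal s < 2 * g x then g x else 0
    have hgg' : ∀ x, g x ≤ g' x + c := by
      intro x
      by_cases h : ENNReal.ofReal s < 2 * g x
      · simp [g', h]
      · have : g x ≤ c := by
          rw [not_lt, hsc] at h
          exact (ENNReal.mul_le_mul_iff_right (by simp) (by simp)).1 h
        exact this.trans le_add_self
    have hMle : ∀ x, maximalOperator a μ g x ≤ maximalOperator a μ g' x + c := by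
      refine fun x => iSup₂_le fun t ht => ?_
      calc (μ (parallelepiped_a a x t))⁻¹ * ∫⁻ y in parallelepiped_a a x t, g y ∂μ
          ≤ (μ (parallelepiped_a a x t))⁻¹ * ∫⁻ y in parallelepiped_a a x t, (g' y + c) ∂μ := by
            gcongr with y
            exact hgg' y
        _ = (μ (parallelepiped_a a x t))⁻¹ * ∫⁻ y in parallelepiped_a a x t, g' y ∂μ + c := by
            rw [lintegral_add_right _ measurable_const, mul_add, hμ.average_const_le x ht]
        _ ≤ _ := by
            gcongr
            exact average_le_maximalOperator g' x ht
    have hsub : {x | ENNReal.ofReal s < maximalOperator a μ g x} ⊆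
        {x | c < maximalOperator a μ g' x} := by
      intro x hx
      have h1 : c + c < maximalOperator a μ g' x + c := by
        rw [← two_mul, ← hsc]; exact lt_of_lt_of_le hx (hMle x)
      exact lt_of_add_lt_add_right h1
    calc ENNReal.ofReal s * μ {x | ENNReal.ofReal s < maximalOperator a μ g x}
        ≤ 2 * c * μ {x | c < maximalOperator a μ g' x} := by
          rw [← hsc]; gcongr
      _ = 2 * (c * μ {x | c < maximalOperator a μ g' x}) := by ring
      _ ≤ 2 * (D * ∫⁻ x, g' x ∂μ) := mul_le_mul' le_rfl (hweak g' c)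
      _ = _ := by ring
  -- Used twice: with F = Mg, φ = 1, r = q to pass to level sets, and with F = 2g, φ = g, r = q - 1
  -- to return.
  have hswap : ∀ (F : (Fin n → ℝ) → ℝ≥0∞) (φ : (Fin n → ℝ) → ℝ≥0∞) (r : ℝ), Measurable F →
      Measurable φ →
      ∫⁻ x, φ x * (∫⁻ s in Set.Ioi (0 : ℝ),
        (if ENNReal.ofReal s < F x then ENNReal.ofReal (s ^ (r - 1)) else 0)) ∂μ =
      ∫⁻ s in Set.Ioi (0 : ℝ), ENNReal.ofReal (s ^ (r - 1)) *
        ∫⁻ x, (if ENNReal.ofReal s < F x then φ x else 0) ∂μ := by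
    intro F φ r hF hφ
    have hmeas : Measurable fun z : (Fin n → ℝ) × ℝ =>
        φ z.1 * (if ENNReal.ofReal z.2 < F z.1 then ENNReal.ofReal (z.2 ^ (r - 1)) else 0) := by
      refine (hφ.comp measurable_fst).mul (Measurable.ite (measurableSet_lt (by fun_prop)
        (hF.comp measurable_fst)) (by fun_prop) measurable_const)
    calc _ = ∫⁻ x, (∫⁻ s in Set.Ioi (0 : ℝ), φ x *
        (if ENNReal.ofReal s < F x then ENNReal.ofReal (s ^ (r - 1)) else 0)) ∂μ := by
          refine lintegral_congr fun x => ?_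
          rw [lintegral_const_mul]
          exact Measurable.ite (measurableSet_lt (by fun_prop) measurable_const) (by fun_prop)
            measurable_const
      _ = _ := by
          rw [lintegral_lintegral_swap hmeas.aemeasurable]
          refine lintegral_congr fun s => ?_
          rw [← lintegral_const_mul _ (Measurable.ite (measurableSet_lt measurable_const hF) hφ
            measurable_const)]
          refine lintegral_congr fun x => ?_
          split_ifs
          · rw [mul_comm]
          · simp
  have hlayer : ∀ x, maximalOperator a μ g x ^ q = ENNReal.ofReal q * (1 * ∫⁻ s in Set.Ioi (0 : ℝ),
      (if ENNReal.ofReal s < maximalOperator a μ g x then ENNReal.ofReal (s ^ (q - 1)) else 0)) := by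
    intro x
    rw [lintegral_rpow_sub_one_lt hq0, one_mul, ← mul_assoc,
      ENNReal.mul_inv_cancel (by simpa using hq0) (by simp), one_mul]
  simp_rw [hlayer]
  rw [lintegral_const_mul', hswap _ (fun _ => 1) q hMm measurable_const, mul_assoc]
  · gcongr
    calc _ ≤ ∫⁻ s in Set.Ioi (0 : ℝ), 2 * D * (ENNReal.ofReal (s ^ (q - 1 - 1)) *
        ∫⁻ x, (if ENNReal.ofReal s < 2 * g x then g x else 0) ∂μ) := by
          refine setLIntegral_mono' measurableSet_Ioi fun s hs => ?_
          have hs' : (0 : ℝ) < s := hs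
          have h1 : ∫⁻ x, (if ENNReal.ofReal s < maximalOperator a μ g x then 1 else 0) ∂μ =
              μ {x | ENNReal.ofReal s < maximalOperator a μ g x} := by
            rw [← lintegral_indicator_one (measurableSet_lt measurable_const hMm)]
            refine lintegral_congr fun x => ?_
            simp [Set.indicator_apply]
          -- One power of s is set aside for the weak type bound; the remaining s^{q-2} is
          -- integrable at 0 because q > 1.
          have h2 : ENNReal.ofReal (s ^ (q - 1)) =
              ENNReal.ofReal (s ^ (q - 1 - 1)) * ENNReal.ofReal s := by
            rw [← ENNReal.ofReal_mul (Real.rpow_nonneg hs'.le _), ← Real.rpow_add_one hs'.ne',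
              sub_add_cancel]
          rw [h1, h2, mul_assoc, mul_left_comm (2 * D)]
          exact mul_le_mul' le_rfl (hlevel s hs')
      _ = 2 * D * ∫⁻ x, g x * ((ENNReal.ofReal (q - 1))⁻¹ * (2 * g x) ^ (q - 1)) ∂μ := by
          rw [lintegral_const_mul' _ _ (by finiteness),
            ← hswap (fun x => 2 * g x) g (q - 1) (hg.const_mul 2) hg]
          simp_rw [lintegral_rpow_sub_one_lt hq1]
      _ = 2 * D * ∫⁻ x, (ENNReal.ofReal (q - 1))⁻¹ * 2 ^ (q - 1) * g x ^ q ∂μ := by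
          congr 1
          refine lintegral_congr fun x => ?_
          have h3 : g x ^ q = g x * g x ^ (q - 1) := by
            conv_lhs => rw [← add_sub_cancel 1 q,
              ENNReal.rpow_add_of_nonneg _ _ zero_le_one hq1.le, ENNReal.rpow_one]
          rw [ENNReal.mul_rpow_of_nonneg _ _ hq1.le, h3]
          ring
      _ = _ := by
          rw [lintegral_const_mul' _ _ (by finiteness), ← mul_assoc]
  · simp

end MaximalOperator

/-! ### Averaging inequalities and Muckenhoupt's theorem. -/

section Muckenhoupt

variable {n : ℕ} {a : Fin n → ℝ} {μ : Measure (Fin n → ℝ)}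

/-- Lebesgue averages are controlled by `L^p` averages relative to `μ`. -/
def AverageBound (a : Fin n → ℝ) (μ : Measure (Fin n → ℝ)) (p : ℝ) (C : ℝ≥0∞) : Prop :=
  ∀ f : (Fin n → ℝ) → ℝ≥0∞, AEMeasurable f volume → ∀ x t, 0 < t →
    (volume (parallelepiped_a a x t))⁻¹ * ∫⁻ y in parallelepiped_a a x t, f y ≤
      C * ((μ (parallelepiped_a a x t))⁻¹ *
        ∫⁻ y in parallelepiped_a a x t, f y ^ p ∂μ) ^ (1 / p)

theorem setLIntegral_withDensity_eq_mul {α : Type*} [MeasurableSpace α] {ν : Measure α}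
    {U f : α → ℝ≥0∞} (hU : AEMeasurable U ν) (hf : AEMeasurable f ν) {s : Set α}
    (hs : MeasurableSet s) :
    ∫⁻ y in s, f y ∂(ν.withDensity U) = ∫⁻ y in s, U y * f y ∂ν := by
  rw [restrict_withDensity hs, lintegral_withDensity_eq_lintegral_mul₀ hU.restrict hf.restrict]
  rfl

/-- Hölder's inequality for f = (f U^{1/p}) V^{1/q}. The product hypotheses are symmetric under
exchanging (U, p) and (V, q), so the lemma serves both the weight and its dual. -/
theorem averageBound_withDensity {U V : (Fin n → ℝ) → ℝ≥0∞} (hU : AEMeasurable U volume)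
    (hV : AEMeasurable V volume) {p q : ℝ} (hpq : p.HolderConjugate q)
    (hUV : ∀ᵐ x, U x ^ (1 / p) * V x ^ (1 / q) = 1) {C : ℝ≥0∞}
    (hU0 : ∀ x t, 0 < t → ∫⁻ y in parallelepiped_a a x t, U y ≠ 0)
    (hUtop : ∀ x t, 0 < t → ∫⁻ y in parallelepiped_a a x t, U y ≠ ∞)
    (hC : ∀ x t, 0 < t → (∫⁻ y in parallelepiped_a a x t, U y) ^ (1 / p) *
      (∫⁻ y in parallelepiped_a a x t, V y) ^ (1 / q) ≤ C * volume (parallelepiped_a a x t)) :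
    AverageBound a (volume.withDensity U) p C := by
  intro f hf x t ht
  have hp0 : 0 < p := hpq.pos
  have hq0 : 0 < q := hpq.symm.pos
  have hp1 : 0 ≤ 1 / p := by positivity
  set E := parallelepiped_a a x t with hE
  have hEm : MeasurableSet E := measurableSet_parallelepiped_a a x t
  have hv0 := (isDoublingOnParallelepipeds_volume a).ne_zero x t ht
  have hvtop := (isDoublingOnParallelepipeds_volume a).ne_top x t ht
  rw [setLIntegral_withDensity_eq_mul hU (hf.pow_const p) hEm, withDensity_apply _ hEm]
  set m := ∫⁻ y in E, U y
  have hhol : ∫⁻ y in E, f y ≤ (∫⁻ y in E, U y * f y ^ p) ^ (1 / p) *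
      (∫⁻ y in E, V y) ^ (1 / q) := by
    calc ∫⁻ y in E, f y = ∫⁻ y in E, ((fun y => f y * U y ^ (1 / p)) * fun y => V y ^ (1 / q)) y := by
          refine lintegral_congr_ae (ae_restrict_of_ae ?_)
          filter_upwards [hUV] with y hy
          simp only [Pi.mul_apply]
          rw [mul_assoc, hy, mul_one]
      _ ≤ _ := ENNReal.lintegral_mul_le_Lp_mul_Lq _ hpq
          (hf.mul (hU.pow_const _)).restrict (hV.pow_const _).restrict
      _ = _ := by
          congr 3 <;> ext y
          · rw [ENNReal.mul_rpow_of_nonneg _ _ hp0.le, ← ENNReal.rpow_mul,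
              one_div_mul_cancel hp0.ne', ENNReal.rpow_one, mul_comm]
          · rw [← ENNReal.rpow_mul, one_div_mul_cancel hq0.ne', ENNReal.rpow_one]
  have hm : (m⁻¹) ^ (1 / p) * m ^ (1 / p) = 1 := by
    rw [← ENNReal.mul_rpow_of_nonneg _ _ hp1,
      ENNReal.inv_mul_cancel (hU0 x t ht) (hUtop x t ht), ENNReal.one_rpow]
  set A := ∫⁻ y in E, U y * f y ^ p
  calc (volume E)⁻¹ * ∫⁻ y in E, f y
      ≤ (volume E)⁻¹ * (A ^ (1 / p) * (∫⁻ y in E, V y) ^ (1 / q)) := by gcongr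
    _ = (volume E)⁻¹ * (A ^ (1 / p) * (((m⁻¹) ^ (1 / p) * m ^ (1 / p)) *
        (∫⁻ y in E, V y) ^ (1 / q))) := by rw [hm, one_mul]
    _ = (volume E)⁻¹ * (A ^ (1 / p) * (m⁻¹) ^ (1 / p)) * (m ^ (1 / p) *
        (∫⁻ y in E, V y) ^ (1 / q)) := by ring
    _ ≤ (volume E)⁻¹ * (A ^ (1 / p) * (m⁻¹) ^ (1 / p)) * (C * volume E) := by
        exact mul_le_mul' le_rfl (hC x t ht)
    _ = ((volume E)⁻¹ * volume E) * (C * ((m⁻¹) ^ (1 / p) * A ^ (1 / p))) := by ring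
    _ = C * (m⁻¹ * A) ^ (1 / p) := by
        rw [ENNReal.inv_mul_cancel hv0 hvtop, one_mul, ENNReal.mul_rpow_of_nonneg _ _ hp1]

/-- Testing the bound on the indicator of E inside its dilate E' gives |E|/|E'| ≤ C
(μ(E)/μ(E'))^{1/p}, and the left side is a fixed constant. -/
theorem AverageBound.isDoublingOnParallelepipeds (ha : ∀ i, 0 < a i) {p : ℝ} (hp : 0 < p)
    {C : ℝ≥0∞} (hC : C ≠ ∞)
    (h : AverageBound a μ p C) (h0 : ∀ x t, 0 < t → μ (parallelepiped_a a x t) ≠ 0)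
    (htop : ∀ x t, 0 < t → μ (parallelepiped_a a x t) ≠ ∞) :
    IsDoublingOnParallelepipeds a μ := by
  refine ⟨h0, htop, fun K hK => ?_⟩
  have hK0 : 0 < K := by linarith
  set D := ∏ i, ENNReal.ofReal (K ^ a i) with hDdef
  have hD : D ≠ ∞ := prod_ofReal_ne_top _
  refine ⟨(D * C) ^ p, by finiteness, fun x t ht => ?_⟩
  set E := parallelepiped_a a x t with hE
  set E' := parallelepiped_a a x (K * t) with hE'
  have hEm : MeasurableSet E := measurableSet_parallelepiped_a a x t
  have hKt : 0 < K * t := by positivity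
  have hsub : E ⊆ E' := parallelepiped_a_mono ha x ht.le (by nlinarith)
  have hvol : volume E' = D * volume E := volume_parallelepiped_a_mul a x x hK0 ht
  have hv0' : volume E' ≠ 0 := (isDoublingOnParallelepipeds_volume a).ne_zero x _ hKt
  have hvtop' : volume E' ≠ ∞ := (isDoublingOnParallelepipeds_volume a).ne_top x _ hKt
  have key := h (E.indicator 1) (aemeasurable_const.indicator hEm) x (K * t) hKt
  have hind : ∀ y, (E.indicator (1 : (Fin n → ℝ) → ℝ≥0∞) y) ^ p = E.indicator 1 y := by
    intro y
    by_cases hy : y ∈ E <;> simp [hy, hp]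
  simp_rw [hind] at key
  rw [lintegral_indicator_one hEm, lintegral_indicator_one hEm, Measure.restrict_apply hEm,
    Measure.restrict_apply hEm, Set.inter_eq_left.2 hsub] at key
  have h1 : 1 ≤ D * C * ((μ E')⁻¹ * μ E) ^ (1 / p) := by
    calc (1 : ℝ≥0∞) = (volume E')⁻¹ * volume E' := (ENNReal.inv_mul_cancel hv0' hvtop').symm
      _ = D * ((volume E')⁻¹ * volume E) := by
          nth_rw 2 [hvol]; ring
      _ ≤ D * (C * ((μ E')⁻¹ * μ E) ^ (1 / p)) := by gcongr
      _ = _ := by ring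
  have h2 : 1 ≤ (D * C) ^ p * ((μ E')⁻¹ * μ E) := by
    have := ENNReal.rpow_le_rpow h1 hp.le
    rwa [ENNReal.one_rpow, ENNReal.mul_rpow_of_nonneg _ _ hp.le, ← ENNReal.rpow_mul,
      one_div_mul_cancel hp.ne', ENNReal.rpow_one] at this
  calc μ E' = μ E' * 1 := (mul_one _).symm
    _ ≤ μ E' * ((D * C) ^ p * ((μ E')⁻¹ * μ E)) := by gcongr
    _ = ((μ E')⁻¹ * μ E') * ((D * C) ^ p * μ E) := by ring
    _ = _ := by rw [ENNReal.inv_mul_cancel (h0 x _ hKt) (htop x _ hKt), one_mul]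

/-- Lerner's argument: the maximal function is dominated by a composition of the weighted
maximal operators attached to the weight and to its dual weight. -/
theorem lintegral_maximalOperator_volume_le (ha : ∀ i, 0 < a i) {U V : (Fin n → ℝ) → ℝ≥0∞}
    (hU : AEMeasurable U volume) {p q : ℝ} (hpq : p.HolderConjugate q)
    (hU0 : ∀ᵐ x, U x ≠ 0) (hUtop : ∀ᵐ x, U x ≠ ∞) (hV : V = fun x => U x ^ (1 - q))
    (hμ : IsDoublingOnParallelepipeds a (volume.withDensity U))
    (hν : IsDoublingOnParallelepipeds a (volume.withDensity V)) {C : ℝ≥0∞} (hC : C ≠ ∞)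
    (hAp : ∀ x t, 0 < t →
      ((volume (parallelepiped_a a x t))⁻¹ * ∫⁻ y in parallelepiped_a a x t, U y) *
      ((volume (parallelepiped_a a x t))⁻¹ * ∫⁻ y in parallelepiped_a a x t, V y) ^ (p - 1)
        ≤ C) :
    ∃ C' : ℝ≥0∞, C' ≠ ∞ ∧ ∀ f : (Fin n → ℝ) → ℝ≥0∞, AEMeasurable f volume →
      ∫⁻ x, maximalOperator a volume f x ^ p ∂(volume.withDensity U) ≤
        C' * ∫⁻ x, f x ^ p ∂(volume.withDensity U) := by
  have hp0 : 0 < p := hpq.pos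
  have hq0 : 0 < q := hpq.symm.pos
  have hp1 : 0 < p - 1 := hpq.sub_one_pos
  have hVm : AEMeasurable V volume := by rw [hV]; exact hU.pow_const _
  have hV0 : ∀ᵐ x, V x ≠ 0 := by
    filter_upwards [hU0, hUtop] with x h0 h1
    rw [hV]
    exact (ENNReal.rpow_pos (pos_iff_ne_zero.2 h0) h1).ne'
  have hVtop : ∀ᵐ x, V x ≠ ∞ := by
    filter_upwards [hU0, hUtop] with x h0 h1
    rw [hV]
    exact ENNReal.rpow_ne_top_of_ne_zero h0 h1
  have hμac : volume.withDensity U ≪ volume := withDensity_absolutelyContinuous _ _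
  have hνac : volume.withDensity V ≪ volume := withDensity_absolutelyContinuous _ _
  obtain ⟨K, hK1, hK⟩ := exists_engulfing ha
  have hK0 : 0 < K := by linarith
  -- Engulfing is applied twice: E(x,t) ⊆ E(y,Kt) ⊆ E(x,K²t) for y in E(x,t).
  obtain ⟨D, hD, hdoub⟩ := hν.doubling (K * K) (by nlinarith)
  obtain ⟨C₁, hC₁, hstr₁⟩ := hμ.strong_type ha hpq.symm.lt
  obtain ⟨C₂, hC₂, hstr₂⟩ := hν.strong_type ha hpq.lt
  refine ⟨(C * D ^ (p - 1)) ^ q * (C₁ * C₂), by finiteness, fun f hf => ?_⟩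
  set μ := volume.withDensity U with hμdef
  set ν := volume.withDensity V with hνdef
  -- F and H are chosen so that f dx = F dν and G^{p-1} dx = H dμ.
  set F : (Fin n → ℝ) → ℝ≥0∞ := fun x => f x * (V x)⁻¹ with hF
  have hFm : AEMeasurable F volume := hf.mul hVm.inv
  set G := maximalOperator a ν F with hG
  have hGm : Measurable G := measurable_maximalOperator ha hν (hFm.mono_ac hνac)
  set H : (Fin n → ℝ) → ℝ≥0∞ := fun x => G x ^ (p - 1) * (U x)⁻¹ with hH
  have hHm : AEMeasurable H volume := (hGm.pow_const _).aemeasurable.mul hU.inv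
  have hpt : ∀ x, maximalOperator a volume f x ^ (p - 1) ≤
      C * D ^ (p - 1) * maximalOperator a μ H x := by
    intro x
    rw [← ENNReal.le_rpow_inv_iff hp1]
    refine iSup₂_le fun t ht => ?_
    rw [ENNReal.le_rpow_inv_iff hp1]
    have hAp' := hAp x t ht
    have hKt : 0 < K * t := by positivity
    have hsubKt : parallelepiped_a a x t ⊆ parallelepiped_a a x (K * t) :=
      parallelepiped_a_mono ha x ht.le (by nlinarith)
    have hEm : MeasurableSet (parallelepiped_a a x t) := measurableSet_parallelepiped_a a x t
    have hv0 := (isDoublingOnParallelepipeds_volume a).ne_zero x t ht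
    have hvtop := (isDoublingOnParallelepipeds_volume a).ne_top x t ht
    have hν0 := hν.ne_zero x t ht
    have hνtop := hν.ne_top x t ht
    have hIF : ∫⁻ y in parallelepiped_a a x t, f y = ∫⁻ y in parallelepiped_a a x t, F y ∂ν := by
      rw [hνdef, setLIntegral_withDensity_eq_mul hVm hFm hEm]
      refine lintegral_congr_ae (ae_restrict_of_ae ?_)
      filter_upwards [hV0, hVtop] with y h0 h1
      rw [hF, mul_left_comm, ENNReal.mul_inv_cancel h0 h1, mul_one]
    -- The ν-average of F over E is dominated by D G(y) at every y of E, so its (p-1)-th power may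
    -- be averaged over E.
    have step1 : ∀ y ∈ parallelepiped_a a x t,
        (ν (parallelepiped_a a x t))⁻¹ * ∫⁻ z in parallelepiped_a a x t, f z ≤ D * G y := by
      intro y hy
      have hxy := mem_parallelepiped_a_comm.1 hy
      have hs1 : parallelepiped_a a x t ⊆ parallelepiped_a a y (K * t) :=
        hK y x t t ht (by linarith) ⟨y, mem_parallelepiped_a_self a y ht, hy⟩
      have hs2 : parallelepiped_a a y (K * t) ⊆ parallelepiped_a a x (K * K * t) := by
        rw [mul_assoc]
        exact hK x y (K * t) (K * t) hKt (by linarith)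
          ⟨y, hsubKt hy, mem_parallelepiped_a_self a y hKt⟩
      have hn0 := hν.ne_zero y _ hKt
      have hntop := hν.ne_top y _ hKt
      calc (ν (parallelepiped_a a x t))⁻¹ * ∫⁻ z in parallelepiped_a a x t, f z
          ≤ (ν (parallelepiped_a a x t))⁻¹ * ∫⁻ z in parallelepiped_a a y (K * t), F z ∂ν := by
            rw [hIF]
            gcongr
        _ = (ν (parallelepiped_a a x t))⁻¹ * (ν (parallelepiped_a a y (K * t)) *
            ((ν (parallelepiped_a a y (K * t)))⁻¹ *
              ∫⁻ z in parallelepiped_a a y (K * t), F z ∂ν)) := by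
            rw [← mul_assoc (ν (parallelepiped_a a y (K * t))), ENNReal.mul_inv_cancel hn0 hntop,
              one_mul]
        _ ≤ (ν (parallelepiped_a a x t))⁻¹ * (D * ν (parallelepiped_a a x t) * G y) := by
            gcongr
            · exact (measure_mono hs2).trans (hdoub x t ht)
            · exact average_le_maximalOperator F y hKt
        _ = ((ν (parallelepiped_a a x t))⁻¹ * ν (parallelepiped_a a x t)) * (D * G y) := by ring
        _ = D * G y := by rw [ENNReal.inv_mul_cancel hν0 hνtop, one_mul]
    have hIH : ∫⁻ y in parallelepiped_a a x t, G y ^ (p - 1) =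
        ∫⁻ y in parallelepiped_a a x t, H y ∂μ := by
      rw [hμdef, setLIntegral_withDensity_eq_mul hU hHm hEm]
      refine lintegral_congr_ae (ae_restrict_of_ae ?_)
      filter_upwards [hU0, hUtop] with y h0 h1
      rw [hH, mul_left_comm, ENNReal.mul_inv_cancel h0 h1, mul_one]
    have hμE : μ (parallelepiped_a a x t) = ∫⁻ y in parallelepiped_a a x t, U y :=
      withDensity_apply _ hEm
    have hνE : ν (parallelepiped_a a x t) = ∫⁻ y in parallelepiped_a a x t, V y :=
      withDensity_apply _ hEm
    rw [← hμE, ← hνE] at hAp'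
    have hm0 := hμ.ne_zero x t ht
    have hmtop := hμ.ne_top x t ht
    have hMH := average_le_maximalOperator (a := a) (μ := μ) H x ht
    set E := parallelepiped_a a x t
    set I := ∫⁻ y in E, f y
    have step2 : ((ν E)⁻¹ * I) ^ (p - 1) * volume E ≤
        D ^ (p - 1) * (μ E * maximalOperator a μ H x) := by
      calc ((ν E)⁻¹ * I) ^ (p - 1) * volume E = ∫⁻ _ in E, ((ν E)⁻¹ * I) ^ (p - 1) := by
            rw [setLIntegral_const]
        _ ≤ ∫⁻ y in E, D ^ (p - 1) * G y ^ (p - 1) := by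
            refine setLIntegral_mono' hEm fun y hy => ?_
            rw [← ENNReal.mul_rpow_of_nonneg _ _ hp1.le]
            exact ENNReal.rpow_le_rpow (step1 y hy) hp1.le
        _ = D ^ (p - 1) * (μ E * ((μ E)⁻¹ * ∫⁻ y in E, H y ∂μ)) := by
            rw [lintegral_const_mul' _ _ (by finiteness), hIH, ← mul_assoc (μ E),
              ENNReal.mul_inv_cancel hm0 hmtop, one_mul]
        _ ≤ _ := by gcongr
    -- Inserting ν(E) and μ(E) isolates exactly the `A_p` product, which is at most C.
    calc ((volume E)⁻¹ * I) ^ (p - 1)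
        = (((volume E)⁻¹ * ν E) * ((ν E)⁻¹ * I)) ^ (p - 1) := by
          congr 1
          rw [mul_assoc, ← mul_assoc (ν E), ENNReal.mul_inv_cancel hν0 hνtop, one_mul]
      _ = ((volume E)⁻¹ * ν E) ^ (p - 1) * ((volume E)⁻¹ *
            (((ν E)⁻¹ * I) ^ (p - 1) * volume E)) := by
          rw [ENNReal.mul_rpow_of_nonneg _ _ hp1.le, mul_left_comm (volume E)⁻¹,
            ENNReal.inv_mul_cancel hv0 hvtop, mul_one]
      _ ≤ ((volume E)⁻¹ * ν E) ^ (p - 1) * ((volume E)⁻¹ *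
            (D ^ (p - 1) * (μ E * maximalOperator a μ H x))) := by gcongr
      _ = (((volume E)⁻¹ * μ E) * ((volume E)⁻¹ * ν E) ^ (p - 1)) *
            (D ^ (p - 1) * maximalOperator a μ H x) := by ring
      _ ≤ C * (D ^ (p - 1) * maximalOperator a μ H x) := by gcongr
      _ = _ := by ring
  -- Exponents match since (p-1)q = p and U · U^{-q} = V.
  have hHq : ∫⁻ x, H x ^ q ∂μ = ∫⁻ x, G x ^ p ∂ν := by
    rw [hμdef, hνdef, lintegral_withDensity_eq_lintegral_mul₀ hU (hHm.pow_const q),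
      lintegral_withDensity_eq_lintegral_mul₀ hVm (hGm.pow_const p).aemeasurable]
    refine lintegral_congr_ae ?_
    filter_upwards [hU0, hUtop] with x h0 h1
    simp only [Pi.mul_apply, hH, hV]
    rw [ENNReal.mul_rpow_of_nonneg _ _ hq0.le, ← ENNReal.rpow_mul, hpq.sub_one_mul_conj,
      ENNReal.inv_rpow, ENNReal.rpow_sub _ _ h0 h1, ENNReal.rpow_one, div_eq_mul_inv]
    ring
  have hFp : ∫⁻ x, F x ^ p ∂ν = ∫⁻ x, f x ^ p ∂μ := by
    rw [hμdef, hνdef, lintegral_withDensity_eq_lintegral_mul₀ hU (hf.pow_const p),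
      lintegral_withDensity_eq_lintegral_mul₀ hVm (hFm.pow_const p)]
    refine lintegral_congr_ae ?_
    filter_upwards [hU0, hUtop] with x h0 h1
    simp only [Pi.mul_apply, hF, hV]
    -- This is (1-q)(1-p) = 1, equivalent to pq = p + q.
    have : U x ^ (1 - q) * (U x ^ (1 - q))⁻¹ ^ p = U x := by
      rw [← ENNReal.rpow_neg, ← ENNReal.rpow_mul, ← ENNReal.rpow_add _ _ h0 h1]
      have : 1 - q + -(1 - q) * p = 1 := by linarith [hpq.mul_eq_add]
      rw [this, ENNReal.rpow_one]
    rw [ENNReal.mul_rpow_of_nonneg _ _ hp0.le, mul_left_comm, this, mul_comm]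
  calc ∫⁻ x, maximalOperator a volume f x ^ p ∂μ
      = ∫⁻ x, (maximalOperator a volume f x ^ (p - 1)) ^ q ∂μ := by
        simp_rw [← ENNReal.rpow_mul, hpq.sub_one_mul_conj]
    _ ≤ ∫⁻ x, (C * D ^ (p - 1)) ^ q * maximalOperator a μ H x ^ q ∂μ := by
        refine lintegral_mono fun x => ?_
        rw [← ENNReal.mul_rpow_of_nonneg _ _ hq0.le]
        exact ENNReal.rpow_le_rpow (hpt x) hq0.le
    _ = (C * D ^ (p - 1)) ^ q * ∫⁻ x, maximalOperator a μ H x ^ q ∂μ :=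
        lintegral_const_mul' _ _ (by finiteness)
    _ ≤ (C * D ^ (p - 1)) ^ q * (C₁ * ∫⁻ x, H x ^ q ∂μ) :=
        mul_le_mul' le_rfl (hstr₁ H (hHm.mono_ac hμac))
    _ ≤ (C * D ^ (p - 1)) ^ q * (C₁ * (C₂ * ∫⁻ x, F x ^ p ∂ν)) := by
        rw [hHq]
        exact mul_le_mul' le_rfl (mul_le_mul' le_rfl (hstr₂ F (hFm.mono_ac hνac)))
    _ = _ := by rw [hFp]; ring

end Muckenhoupt

theorem inv_volume_parallelepiped_a_le {n : ℕ} (a x y : Fin n → ℝ) {K t : ℝ} (hK : 0 < K)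
    (ht : 0 < t) :
    (volume (parallelepiped_a a x t))⁻¹ ≤
      (∏ i, ENNReal.ofReal (K ^ a i)) * (volume (parallelepiped_a a y (K * t)))⁻¹ := by
  have hv := isDoublingOnParallelepipeds_volume a
  have hKt : 0 < K * t := by positivity
  have hD : ∏ i, ENNReal.ofReal (K ^ a i) ≠ ∞ := prod_ofReal_ne_top _
  have h0 := hv.ne_zero y _ hKt
  rw [ENNReal.inv_le_iff_le_mul (fun h => absurd h (by finiteness))
    (fun h => absurd h (hv.ne_top x t ht)), ← mul_assoc, mul_comm (volume _),
    ← volume_parallelepiped_a_mul a y x hK ht, ENNReal.mul_inv_cancel h0 (hv.ne_top y _ hKt)]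

/-! ### Consequences of the `A_p` and `A_1` conditions. -/

section Weights

variable {n : ℕ} {a : Fin n → ℝ} {w : (Fin n → ℝ) → ℝ}

theorem IsWeight.aemeasurable_ofReal (hw : IsWeight w) :
    AEMeasurable (fun x => ENNReal.ofReal (w x)) volume :=
  hw.1.aestronglyMeasurable.aemeasurable.ennreal_ofReal

theorem IsWeight.ae_ofReal_ne_zero (hw : IsWeight w) : ∀ᵐ x, ENNReal.ofReal (w x) ≠ 0 := by
  filter_upwards [hw.2] with x hx
  simpa using hx

theorem IsWeight.volume_absolutelyContinuous (hw : IsWeight w) : volume ≪ weightMeasure w :=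
  withDensity_absolutelyContinuous' hw.aemeasurable_ofReal hw.ae_ofReal_ne_zero

instance (w : (Fin n → ℝ) → ℝ) : SFinite (weightMeasure w) := by
  unfold weightMeasure; infer_instance

theorem weightMeasure_parallelepiped_a (w : (Fin n → ℝ) → ℝ) (x : Fin n → ℝ) (t : ℝ) :
    weightMeasure w (parallelepiped_a a x t) =
      ∫⁻ y in parallelepiped_a a x t, ENNReal.ofReal (w y) :=
  withDensity_apply _ (measurableSet_parallelepiped_a a x t)

theorem IsWeight.weightMeasure_ne_zero (hw : IsWeight w) (x : Fin n → ℝ) {t : ℝ} (ht : 0 < t) :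
    weightMeasure w (parallelepiped_a a x t) ≠ 0 := fun h =>
  (isDoublingOnParallelepipeds_volume a).ne_zero x t ht (hw.volume_absolutelyContinuous h)

theorem IsWeight.weightMeasure_ne_top (hw : IsWeight w) (x : Fin n → ℝ) (t : ℝ) :
    weightMeasure w (parallelepiped_a a x t) ≠ ∞ := by
  rw [weightMeasure_parallelepiped_a]
  have h := (hw.1.integrableOn_isCompact (isCompact_parallelepiped_a a x t)).hasFiniteIntegral
  refine (lt_of_le_of_lt (lintegral_mono fun y => ?_) h).ne
  exact Real.ofReal_le_enorm (w y)

/-- Muckenhoupt's theorem, together with the averaging inequality for `A_p` weights. -/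
theorem MuckenhouptAp.averageBound_and_strong_type (ha : ∀ i, 0 < a i) {p : ℝ} (hp : 1 < p)
    (hw : MuckenhouptAp a p w) :
    (∃ C : ℝ≥0∞, C ≠ ∞ ∧ AverageBound a (weightMeasure w) p C) ∧
    ∃ C : ℝ≥0∞, C ≠ ∞ ∧ ∀ f : (Fin n → ℝ) → ℝ≥0∞, AEMeasurable f volume →
      ∫⁻ x, maximalOperator a volume f x ^ p ∂(weightMeasure w) ≤
        C * ∫⁻ x, f x ^ p ∂(weightMeasure w) := by
  obtain ⟨hw, C, hC1, hAp⟩ := hw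
  have hpq : p.HolderConjugate p.conjExponent := Real.HolderConjugate.conjExponent hp
  set q := p.conjExponent
  have hp0 : 0 < p := hpq.pos
  have hq0 : 0 < q := hpq.symm.pos
  have hp1 : 0 < p - 1 := hpq.sub_one_pos
  set U : (Fin n → ℝ) → ℝ≥0∞ := fun x => ENNReal.ofReal (w x) with hU
  set V : (Fin n → ℝ) → ℝ≥0∞ := fun x => U x ^ (1 - q) with hV
  have hUm : AEMeasurable U volume := hw.aemeasurable_ofReal
  have hVm : AEMeasurable V volume := hUm.pow_const _
  have hUae : ∀ᵐ x, U x ≠ 0 := hw.ae_ofReal_ne_zero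
  have hUtop : ∀ x, U x ≠ ∞ := fun x => ENNReal.ofReal_ne_top
  have hVae : ∀ᵐ x, V x ≠ 0 := by
    filter_upwards [hUae] with x h0
    exact (ENNReal.rpow_pos (pos_iff_ne_zero.2 h0) (hUtop x)).ne'
  have hUI0 : ∀ x t, 0 < t → ∫⁻ y in parallelepiped_a a x t, U y ≠ 0 := fun x t ht => by
    rw [← weightMeasure_parallelepiped_a]; exact hw.weightMeasure_ne_zero x ht
  have hUItop : ∀ x t, 0 < t → ∫⁻ y in parallelepiped_a a x t, U y ≠ ∞ := fun x t ht => by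
    rw [← weightMeasure_parallelepiped_a]; exact hw.weightMeasure_ne_top x t
  have hvol := isDoublingOnParallelepipeds_volume a
  have hVI0 : ∀ x t, 0 < t → ∫⁻ y in parallelepiped_a a x t, V y ≠ 0 := by
    intro x t ht h
    rw [← withDensity_apply _ (measurableSet_parallelepiped_a a x t)] at h
    exact hvol.ne_zero x t ht (withDensity_absolutelyContinuous' hVm hVae h)
  -- Local integrability of the dual weight is forced by `A_p`: otherwise the product would be
  -- infinite, as the average of w is nonzero.
  have hVItop : ∀ x t, 0 < t → ∫⁻ y in parallelepiped_a a x t, V y ≠ ∞ := by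
    intro x t ht h
    have := hAp x t ht
    rw [h, ENNReal.mul_top (ENNReal.inv_ne_zero.2 (hvol.ne_top x t ht)),
      ENNReal.top_rpow_of_pos hp1, ENNReal.mul_top] at this
    · exact ENNReal.ofReal_ne_top (top_le_iff.1 this)
    · exact mul_ne_zero (ENNReal.inv_ne_zero.2 (hvol.ne_top x t ht)) (hUI0 x t ht)
  have hsum : 1 / p + 1 / q = 1 := by
    rw [one_div, one_div]; exact hpq.inv_add_inv_eq_one
  have hexp : (p - 1) * (1 / p) = 1 / q := by
    have : p * (1 / p) = 1 := mul_one_div_cancel hp0.ne'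
    linarith
  have hUV : ∀ᵐ x, U x ^ (1 / p) * V x ^ (1 / q) = 1 := by
    filter_upwards [hUae] with x h0
    have h3 : 1 / p + (1 - q) * (1 / q) = 0 := by
      have : q * (1 / q) = 1 := mul_one_div_cancel hq0.ne'
      linarith
    rw [hV, ← ENNReal.rpow_mul, ← ENNReal.rpow_add _ _ h0 (hUtop x), h3, ENNReal.rpow_zero]
  have hbound : ∀ x t, 0 < t → (∫⁻ y in parallelepiped_a a x t, U y) ^ (1 / p) *
      (∫⁻ y in parallelepiped_a a x t, V y) ^ (1 / q) ≤
        ENNReal.ofReal C ^ (1 / p) * volume (parallelepiped_a a x t) := by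
    intro x t ht
    -- The p-th root of the `A_p` condition is symmetric in the two weights, because (p-1)/p = 1/q.
    have h1 := ENNReal.rpow_le_rpow (hAp x t ht) (z := 1 / p) (by positivity)
    have hv0 := hvol.ne_zero x t ht
    have hvtop := hvol.ne_top x t ht
    rw [ENNReal.mul_rpow_of_nonneg _ _ (by positivity), ← ENNReal.rpow_mul, hexp,
      ENNReal.mul_rpow_of_nonneg _ _ (by positivity),
      ENNReal.mul_rpow_of_nonneg _ _ (by positivity)] at h1
    set E := parallelepiped_a a x t
    have h2 : (volume E)⁻¹ ^ (1 / p) * (volume E)⁻¹ ^ (1 / q) = (volume E)⁻¹ := by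
      rw [← ENNReal.rpow_add _ _ (ENNReal.inv_ne_zero.2 hvtop) (ENNReal.inv_ne_top.2 hv0), hsum,
        ENNReal.rpow_one]
    calc (∫⁻ y in E, U y) ^ (1 / p) * (∫⁻ y in E, V y) ^ (1 / q)
        = ((∫⁻ y in E, U y) ^ (1 / p) * (∫⁻ y in E, V y) ^ (1 / q)) *
          ((volume E)⁻¹ * volume E) := by rw [ENNReal.inv_mul_cancel hv0 hvtop, mul_one]
      _ = ((volume E)⁻¹ ^ (1 / p) * (∫⁻ y in E, U y) ^ (1 / p) *
          ((volume E)⁻¹ ^ (1 / q) * (∫⁻ y in E, V y) ^ (1 / q))) * volume E := by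
          nth_rw 1 [← h2]; ring
      _ ≤ _ := by gcongr
  have hCtop : ENNReal.ofReal C ^ (1 / p) ≠ ∞ := by finiteness
  have hAB : AverageBound a (volume.withDensity U) p (ENNReal.ofReal C ^ (1 / p)) :=
    averageBound_withDensity hUm hVm hpq hUV hUI0 hUItop hbound
  have hAB' : AverageBound a (volume.withDensity V) q (ENNReal.ofReal C ^ (1 / p)) :=
    averageBound_withDensity hVm hUm hpq.symm (by simpa only [mul_comm] using hUV) hVI0 hVItop
      (by simpa only [mul_comm] using hbound)
  refine ⟨⟨_, hCtop, hAB⟩, ?_⟩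
  refine lintegral_maximalOperator_volume_le ha hUm hpq hUae (.of_forall hUtop) rfl
    (hAB.isDoublingOnParallelepipeds ha hp0 hCtop ?_ ?_)
    (hAB'.isDoublingOnParallelepipeds ha hq0 hCtop ?_ ?_) (C := ENNReal.ofReal C)
    ENNReal.ofReal_ne_top hAp
  all_goals
    intro x t ht
    rw [withDensity_apply _ (measurableSet_parallelepiped_a a x t)]
    first
    | exact hUI0 x t ht
    | exact hUItop x t ht
    | exact hVI0 x t ht
    | exact hVItop x t ht

/-- Engulfing turns the centred `A_1` condition into w(E)/|E| ≤ DC w(y) for almost every y in E;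
multiplying by f and integrating over E gives the bound. -/
theorem MuckenhouptA1.averageBound (ha : ∀ i, 0 < a i) (hw : MuckenhouptA1 a w) :
    ∃ C : ℝ≥0∞, C ≠ ∞ ∧ AverageBound a (weightMeasure w) 1 C := by
  obtain ⟨hw, C, hC1, hA1⟩ := hw
  obtain ⟨K, hK1, hK⟩ := exists_engulfing ha
  have hK0 : 0 < K := by linarith
  set D := ∏ i, ENNReal.ofReal (K ^ a i) with hDdef
  have hD : D ≠ ∞ := prod_ofReal_ne_top _
  refine ⟨D * ENNReal.ofReal C, by finiteness, fun f hf x t ht => ?_⟩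
  have hEm : MeasurableSet (parallelepiped_a a x t) := measurableSet_parallelepiped_a a x t
  have hm0 := hw.weightMeasure_ne_zero (a := a) x ht
  have hmtop := hw.weightMeasure_ne_top (a := a) x t
  have hav : ∀ᵐ y, y ∈ parallelepiped_a a x t →
      (volume (parallelepiped_a a x t))⁻¹ * weightMeasure w (parallelepiped_a a x t) ≤
        D * ENNReal.ofReal C * ENNReal.ofReal (w y) := by
    filter_upwards [hA1] with y hy hyE
    have hKt : 0 < K * t := by positivity
    have hs1 : parallelepiped_a a x t ⊆ parallelepiped_a a y (K * t) :=
      hK y x t t ht (by linarith) ⟨y, mem_parallelepiped_a_self a y ht, hyE⟩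
    have hle := inv_volume_parallelepiped_a_le a x y hK0 ht
    calc (volume (parallelepiped_a a x t))⁻¹ * weightMeasure w (parallelepiped_a a x t)
        ≤ D * (volume (parallelepiped_a a y (K * t)))⁻¹ *
            ∫⁻ z in parallelepiped_a a y (K * t), ‖w z‖ₑ := by
          rw [weightMeasure_parallelepiped_a]
          refine mul_le_mul' hle ((lintegral_mono_set hs1).trans (lintegral_mono fun z => ?_))
          exact Real.ofReal_le_enorm (w z)
      _ ≤ D * anisoMaximal a w y := by
          rw [mul_assoc]
          exact mul_le_mul' le_rfl
            (average_le_maximalOperator (μ := volume) (fun z => ‖w z‖ₑ) y hKt)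
      _ ≤ D * ENNReal.ofReal (C * w y) := by gcongr
      _ = _ := by rw [ENNReal.ofReal_mul (by linarith), mul_assoc]
  simp only [ENNReal.rpow_one, div_one]
  have hint : ∫⁻ y in parallelepiped_a a x t, f y ∂(weightMeasure w) =
      ∫⁻ y in parallelepiped_a a x t, ENNReal.ofReal (w y) * f y :=
    setLIntegral_withDensity_eq_mul hw.aemeasurable_ofReal hf hEm
  rw [hint]
  set E := parallelepiped_a a x t
  set m := weightMeasure w E
  calc (volume E)⁻¹ * ∫⁻ y in E, f y
      = m⁻¹ * (((volume E)⁻¹ * m) * ∫⁻ y in E, f y) := by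
        rw [mul_comm (volume E)⁻¹ m, ← mul_assoc, ← mul_assoc, ENNReal.inv_mul_cancel hm0 hmtop,
          one_mul]
    _ ≤ m⁻¹ * ∫⁻ y in E, D * ENNReal.ofReal C * (ENNReal.ofReal (w y) * f y) := by
        rw [← lintegral_const_mul'' _ hf.restrict]
        refine mul_le_mul' le_rfl (lintegral_mono_ae ((ae_restrict_iff' hEm).2 ?_))
        filter_upwards [hav] with y hy hyE
        rw [← mul_assoc]
        exact mul_le_mul' (hy hyE) le_rfl
    _ = _ := by
        rw [lintegral_const_mul' _ _ (by finiteness)]; ring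

end Weights

/-! ### Morrey space estimates. -/

section Morrey

variable {n : ℕ} {a : Fin n → ℝ}

/-- Local–global splitting by radius. For t ≤ r the box stays in E(x₀,Kr); for t ≥ r it lies in
E(x₀,Kt), of comparable volume, whose average is at most B. Splitting radii rather than f produces a
maximum instead of a sum. -/
theorem maximalOperator_le_max_of_mem (ha : ∀ i, 0 < a i) :
    ∃ K : ℝ, 1 ≤ K ∧ ∃ D : ℝ≥0∞, D ≠ ∞ ∧ ∀ (g : (Fin n → ℝ) → ℝ≥0∞) (x₀ : Fin n → ℝ) (r : ℝ),
      0 < r → ∀ B : ℝ≥0∞, (∀ s, r ≤ s → (volume (parallelepiped_a a x₀ s))⁻¹ *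
        ∫⁻ y in parallelepiped_a a x₀ s, g y ≤ B) → ∀ x ∈ parallelepiped_a a x₀ r,
      maximalOperator a volume g x ≤
        max (maximalOperator a volume ((parallelepiped_a a x₀ (K * r)).indicator g) x)
          (D * B) := by
  obtain ⟨K, hK1, hK⟩ := exists_engulfing ha
  have hK0 : 0 < K := by linarith
  set D := ∏ i, ENNReal.ofReal (K ^ a i) with hDdef
  have hD : D ≠ ∞ := prod_ofReal_ne_top _
  refine ⟨K, hK1, D, hD, fun g x₀ r hr B hB x hx => iSup₂_le fun t ht => ?_⟩
  rcases le_total t r with htr | hrt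
  · refine le_max_of_le_left ?_
    have hsub : parallelepiped_a a x t ⊆ parallelepiped_a a x₀ (K * r) :=
      hK x₀ x t r ht (by linarith) ⟨x, hx, mem_parallelepiped_a_self a x ht⟩
    have heq : ∫⁻ y in parallelepiped_a a x t, g y =
        ∫⁻ y in parallelepiped_a a x t, (parallelepiped_a a x₀ (K * r)).indicator g y :=
      setLIntegral_congr_fun (measurableSet_parallelepiped_a a x t) fun y hy => by
        rw [Set.indicator_of_mem (hsub hy)]
    rw [heq]
    exact average_le_maximalOperator _ x ht
  · refine le_max_of_le_right ?_
    have hsub : parallelepiped_a a x t ⊆ parallelepiped_a a x₀ (K * t) :=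
      hK x₀ x t t ht (by linarith)
        ⟨x, parallelepiped_a_mono ha x₀ hr.le hrt hx, mem_parallelepiped_a_self a x ht⟩
    have hKt : 0 < K * t := by positivity
    have hle := inv_volume_parallelepiped_a_le a x x₀ hK0 ht
    calc (volume (parallelepiped_a a x t))⁻¹ * ∫⁻ y in parallelepiped_a a x t, g y
        ≤ D * (volume (parallelepiped_a a x₀ (K * t)))⁻¹ *
          ∫⁻ y in parallelepiped_a a x₀ (K * t), g y := mul_le_mul' hle (lintegral_mono_set hsub)
      _ ≤ D * B := by
        rw [mul_assoc]
        exact mul_le_mul' le_rfl (hB _ (by nlinarith))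

theorem lintegral_rpow_le_morreyNorm {β : Type*} [ENorm β] {p κ : ℝ} (hp : 0 < p)
    {w : (Fin n → ℝ) → ℝ} (hw : IsWeight w) (f : (Fin n → ℝ) → β)
    (x : Fin n → ℝ) {t : ℝ} (ht : 0 < t) :
    ∫⁻ y in parallelepiped_a a x t, ‖f y‖ₑ ^ p ∂(weightMeasure w) ≤
      weightMeasure w (parallelepiped_a a x t) ^ κ * morreyNorm a p κ w f ^ p := by
  have hm0 := hw.weightMeasure_ne_zero (a := a) x ht
  have hmtop := hw.weightMeasure_ne_top (a := a) x t
  have h : ((weightMeasure w (parallelepiped_a a x t) ^ κ)⁻¹ *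
      ∫⁻ y in parallelepiped_a a x t, ‖f y‖ₑ ^ p ∂(weightMeasure w)) ^ (1 / p) ≤
        morreyNorm a p κ w f := by
    unfold morreyNorm
    exact le_iSup_of_le x (le_iSup₂_of_le t ht le_rfl)
  rw [one_div, ENNReal.rpow_inv_le_iff hp] at h
  have hk0 : weightMeasure w (parallelepiped_a a x t) ^ κ ≠ 0 :=
    (ENNReal.rpow_pos (pos_iff_ne_zero.2 hm0) hmtop).ne'
  have hktop : weightMeasure w (parallelepiped_a a x t) ^ κ ≠ ∞ :=
      ENNReal.rpow_ne_top_of_ne_zero hm0 hmtop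
  calc _ = weightMeasure w (parallelepiped_a a x t) ^ κ *
      ((weightMeasure w (parallelepiped_a a x t) ^ κ)⁻¹ *
      ∫⁻ y in parallelepiped_a a x t, ‖f y‖ₑ ^ p ∂(weightMeasure w)) := by
        rw [← mul_assoc, ENNReal.mul_inv_cancel hk0 hktop, one_mul]
    _ ≤ _ := by gcongr

/-- The bound on the larger box carries w(E(x,s))^{(κ-1)/p}; the exponent is nonpositive, so the
smaller box may replace it. No summation over dyadic shells is needed. -/
theorem AverageBound.average_le_morreyNorm {β : Type*} [ENorm β] (ha : ∀ i, 0 < a i) {p κ : ℝ}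
    (hp : 0 < p) {w : (Fin n → ℝ) → ℝ} (hw : IsWeight w) (hκ1 : κ ≤ 1)
    {C : ℝ≥0∞} (h : AverageBound a (weightMeasure w) p C) (f : (Fin n → ℝ) → β)
    (hf : AEMeasurable (fun y => ‖f y‖ₑ) volume) (x : Fin n → ℝ) {r s : ℝ} (hr : 0 < r)
    (hrs : r ≤ s) :
    (volume (parallelepiped_a a x s))⁻¹ * ∫⁻ y in parallelepiped_a a x s, ‖f y‖ₑ ≤
      C * ((weightMeasure w (parallelepiped_a a x r) ^ (κ - 1)) ^ (1 / p) *
        morreyNorm a p κ w f) := by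
  have hs : 0 < s := hr.trans_le hrs
  have hm0 := hw.weightMeasure_ne_zero (a := a) x hs
  have hmtop := hw.weightMeasure_ne_top (a := a) x s
  refine (h _ hf x s hs).trans ?_
  gcongr
  have hle : (weightMeasure w (parallelepiped_a a x s))⁻¹ *
      ∫⁻ y in parallelepiped_a a x s, ‖f y‖ₑ ^ p ∂(weightMeasure w) ≤
      weightMeasure w (parallelepiped_a a x r) ^ (κ - 1) * morreyNorm a p κ w f ^ p := by
    calc _ ≤ (weightMeasure w (parallelepiped_a a x s))⁻¹ *
        (weightMeasure w (parallelepiped_a a x s) ^ κ * morreyNorm a p κ w f ^ p) := by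
          gcongr
          exact lintegral_rpow_le_morreyNorm hp hw f x hs
      _ = weightMeasure w (parallelepiped_a a x s) ^ (κ - 1) * morreyNorm a p κ w f ^ p := by
          rw [ENNReal.rpow_sub _ _ hm0 hmtop, ENNReal.rpow_one, div_eq_mul_inv]; ring
      _ ≤ _ := by
          gcongr ?_ * _
          rw [← neg_sub, ENNReal.rpow_neg, ENNReal.rpow_neg, ENNReal.inv_le_inv]
          exact ENNReal.rpow_le_rpow (measure_mono (parallelepiped_a_mono ha x hr.le hrs))
            (by linarith)
  refine (ENNReal.rpow_le_rpow hle (by positivity)).trans_eq ?_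
  rw [ENNReal.mul_rpow_of_nonneg _ _ (by positivity), ← ENNReal.rpow_mul (morreyNorm a p κ w f),
    mul_one_div_cancel hp.ne', ENNReal.rpow_one]

theorem MemMorrey.aemeasurable_enorm {β : Type*} [NormedAddCommGroup β] {p κ : ℝ}
    {w : (Fin n → ℝ) → ℝ} (hw : IsWeight w) {f : (Fin n → ℝ) → β} (hf : MemMorrey a p κ w f) :
    AEMeasurable (fun y => ‖f y‖ₑ) volume :=
  (hf.1.aestronglyMeasurable.mono_ac hw.volume_absolutelyContinuous).enorm

theorem setLIntegral_indicator_parallelepiped_le {β : Type*} [ENorm β] {p κ : ℝ} (hp : 0 < p)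
    {w : (Fin n → ℝ) → ℝ} (hw : IsWeight w) (hκ : 0 ≤ κ) {K : ℝ} {D : ℝ≥0∞} (hK : 0 < K)
    (hD : ∀ x t, 0 < t → weightMeasure w (parallelepiped_a a x (K * t)) ≤
      D * weightMeasure w (parallelepiped_a a x t)) (f : (Fin n → ℝ) → β)
    (x : Fin n → ℝ) {r : ℝ} (hr : 0 < r) :
    ∫⁻ y, (parallelepiped_a a x (K * r)).indicator (fun y => ‖f y‖ₑ) y ^ p ∂(weightMeasure w) ≤
      D ^ κ * (weightMeasure w (parallelepiped_a a x r) ^ κ * morreyNorm a p κ w f ^ p) := by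
  have hKr : 0 < K * r := by positivity
  calc _ = ∫⁻ y in parallelepiped_a a x (K * r), ‖f y‖ₑ ^ p ∂(weightMeasure w) := by
        rw [← lintegral_indicator (measurableSet_parallelepiped_a a x _)]
        refine lintegral_congr fun y => ?_
        by_cases hy : y ∈ parallelepiped_a a x (K * r) <;> simp [hy, hp]
    _ ≤ weightMeasure w (parallelepiped_a a x (K * r)) ^ κ * morreyNorm a p κ w f ^ p :=
        lintegral_rpow_le_morreyNorm hp hw f x hKr
    _ ≤ (D * weightMeasure w (parallelepiped_a a x r)) ^ κ * morreyNorm a p κ w f ^ p := by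
        gcongr
        exact hD x r hr
    _ = _ := by rw [ENNReal.mul_rpow_of_nonneg _ _ hκ, mul_assoc]

theorem MuckenhouptAp.exists_setLIntegral_anisoMaximal_le {β : Type*} [NormedAddCommGroup β]
    (ha : ∀ i, 0 < a i) {p κ : ℝ} (hp : 1 < p) (hκ0 : 0 ≤ κ) (hκ1 : κ ≤ 1)
    {w : (Fin n → ℝ) → ℝ} (hAp : MuckenhouptAp a p w) :
    ∃ C : ℝ≥0∞, C ≠ ∞ ∧ ∀ f : (Fin n → ℝ) → β, MemMorrey a p κ w f → ∀ x r, 0 < r →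
      ∫⁻ y in parallelepiped_a a x r, anisoMaximal a f y ^ p ∂(weightMeasure w) ≤
        C * (weightMeasure w (parallelepiped_a a x r) ^ κ * morreyNorm a p κ w f ^ p) := by
  have hw : IsWeight w := hAp.1
  have hp0 : 0 < p := by linarith
  obtain ⟨⟨A, hA, hAB⟩, S, hS, hstrong⟩ := hAp.averageBound_and_strong_type ha hp
  have hμ := hAB.isDoublingOnParallelepipeds ha hp0 hA (fun x _ ht => hw.weightMeasure_ne_zero x ht)
    (fun x t _ => hw.weightMeasure_ne_top x t)
  obtain ⟨K, hK1, D, hD, hmax⟩ := maximalOperator_le_max_of_mem ha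
  obtain ⟨D', hD', hdoub⟩ := hμ.doubling K hK1
  refine ⟨S * D' ^ κ + (D * A) ^ p, by finiteness, fun f hf x r hr => ?_⟩
  have hfm := hf.aemeasurable_enorm hw
  set μ := weightMeasure w with hμdef
  set N := morreyNorm a p κ w f with hN
  set B := A * ((μ (parallelepiped_a a x r) ^ (κ - 1)) ^ (1 / p) * N) with hB
  have hpt := hmax (fun y => ‖f y‖ₑ) x r hr B fun s hs =>
    hAB.average_le_morreyNorm ha hp0 hw hκ1 f hfm x hr hs
  have hloc := setLIntegral_indicator_parallelepiped_le (a := a) hp0 hw hκ0 (by linarith) hdoub f x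
    hr
  have hm0 := hμ.ne_zero x r hr
  have hmtop := hμ.ne_top x r hr
  have hEm : MeasurableSet (parallelepiped_a a x r) := measurableSet_parallelepiped_a a x r
  set E := parallelepiped_a a x r
  set E' := parallelepiped_a a x (K * r)
  -- Integrating the constant over E adds one power of μ(E), turning κ - 1 into κ.
  have hBp : (D * B) ^ p * μ E = (D * A) ^ p * (μ E ^ κ * N ^ p) := by
    rw [hB, ← mul_assoc D A, ENNReal.mul_rpow_of_nonneg _ _ hp0.le,
      ENNReal.mul_rpow_of_nonneg _ N hp0.le, ← ENNReal.rpow_mul _ (1 / p),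
      one_div_mul_cancel hp0.ne', ENNReal.rpow_one, ENNReal.rpow_sub _ _ hm0 hmtop,
      ENNReal.rpow_one, div_eq_mul_inv]
    calc (D * A) ^ p * (μ E ^ κ * (μ E)⁻¹ * N ^ p) * μ E
        = (D * A) ^ p * (μ E ^ κ * N ^ p) * ((μ E)⁻¹ * μ E) := by ring
      _ = _ := by rw [ENNReal.inv_mul_cancel hm0 hmtop, mul_one]
  calc ∫⁻ y in E, anisoMaximal a f y ^ p ∂μ
      ≤ ∫⁻ y in E, (maximalOperator a volume (E'.indicator fun y => ‖f y‖ₑ) y ^ p +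
          (D * B) ^ p) ∂μ := by
        refine setLIntegral_mono' hEm fun y hy => ?_
        rcases le_max_iff.1 (hpt y hy) with h | h
        · exact le_add_right (ENNReal.rpow_le_rpow h hp0.le)
        · exact le_add_left (ENNReal.rpow_le_rpow h hp0.le)
    _ = ∫⁻ y in E, maximalOperator a volume (E'.indicator fun y => ‖f y‖ₑ) y ^ p ∂μ +
          (D * B) ^ p * μ E := by
        rw [lintegral_add_right _ measurable_const, setLIntegral_const]
    _ ≤ S * ∫⁻ y, (E'.indicator fun y => ‖f y‖ₑ) y ^ p ∂μ + (D * B) ^ p * μ E := by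
        refine add_le_add ((setLIntegral_le_lintegral _ _).trans (hstrong _ ?_)) le_rfl
        exact hfm.indicator (measurableSet_parallelepiped_a a x _)
    _ ≤ S * (D' ^ κ * (μ E ^ κ * N ^ p)) + (D * A) ^ p * (μ E ^ κ * N ^ p) := by
        rw [hBp]
        exact add_le_add (mul_le_mul' le_rfl hloc) le_rfl
    _ = _ := by ring

/-- `M` is bounded on the weighted anisotropic Morrey space for `A_p` weights, `1 < p < ∞`. -/
theorem MuckenhouptAp.exists_morreyNorm_anisoMaximal_le {β : Type*} [NormedAddCommGroup β]
    (ha : ∀ i, 0 < a i) {p κ : ℝ} (hp : 1 < p) (hκ0 : 0 ≤ κ) (hκ1 : κ ≤ 1)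
    {w : (Fin n → ℝ) → ℝ} (hAp : MuckenhouptAp a p w) :
    ∃ C : ℝ, 0 < C ∧ ∀ f : (Fin n → ℝ) → β, MemMorrey a p κ w f →
      MemMorrey a p κ w (anisoMaximal a f) ∧
      morreyNorm a p κ w (anisoMaximal a f) ≤ ENNReal.ofReal C * morreyNorm a p κ w f := by
  have hw : IsWeight w := hAp.1
  have hp0 : 0 < p := by linarith
  obtain ⟨C, hC, hbound⟩ := hAp.exists_setLIntegral_anisoMaximal_le (β := β) ha hp hκ0 hκ1
  have hCp : C ^ (1 / p) ≠ ∞ := by finiteness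
  have hCle : C ^ (1 / p) ≤ ENNReal.ofReal ((C ^ (1 / p)).toReal + 1) := by
    conv_lhs => rw [← ENNReal.ofReal_toReal hCp]
    exact ENNReal.ofReal_le_ofReal (by linarith)
  -- The added 1 only makes the constant strictly positive.
  refine ⟨(C ^ (1 / p)).toReal + 1, by positivity, fun f hf => ?_⟩
  have hfm := hf.aemeasurable_enorm hw
  have hnorm : morreyNorm a p κ w (anisoMaximal a f) ≤
      ENNReal.ofReal ((C ^ (1 / p)).toReal + 1) * morreyNorm a p κ w f := by
    refine iSup_le fun x => iSup₂_le fun t ht => ?_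
    have hm0 := hw.weightMeasure_ne_zero (a := a) x ht
    have hmtop := hw.weightMeasure_ne_top (a := a) x t
    have hk0 : weightMeasure w (parallelepiped_a a x t) ^ κ ≠ 0 :=
      (ENNReal.rpow_pos (pos_iff_ne_zero.2 hm0) hmtop).ne'
    have hktop : weightMeasure w (parallelepiped_a a x t) ^ κ ≠ ∞ :=
      ENNReal.rpow_ne_top_of_ne_zero hm0 hmtop
    refine le_trans ?_ (mul_le_mul' hCle le_rfl)
    rw [one_div, ENNReal.rpow_inv_le_iff hp0, ENNReal.mul_rpow_of_nonneg _ _ hp0.le,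
      ENNReal.rpow_inv_rpow hp0.ne']
    calc _ ≤ (weightMeasure w (parallelepiped_a a x t) ^ κ)⁻¹ *
        (C * (weightMeasure w (parallelepiped_a a x t) ^ κ * morreyNorm a p κ w f ^ p)) := by
          gcongr
          exact hbound f hf x t ht
      _ = ((weightMeasure w (parallelepiped_a a x t) ^ κ)⁻¹ *
          weightMeasure w (parallelepiped_a a x t) ^ κ) * (C * morreyNorm a p κ w f ^ p) := by
          ring
      _ = _ := by rw [ENNReal.inv_mul_cancel hk0 hktop, one_mul]
  refine ⟨⟨fun x => ?_, hnorm.trans_lt (ENNReal.mul_lt_top ENNReal.ofReal_lt_top hf.2)⟩, hnorm⟩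
  have hMm : Measurable (anisoMaximal a f) :=
    measurable_maximalOperator ha (isDoublingOnParallelepipeds_volume a) hfm
  refine ⟨parallelepiped_a a x 1, parallelepiped_a_mem_nhds a x one_pos,
    hMm.aestronglyMeasurable, ?_⟩
  have hmtop := hw.weightMeasure_ne_top (a := a) x 1
  -- Local integrability follows from Mf ≤ (Mf)^p + 1 and the finite weight of the box.
  calc ∫⁻ y in parallelepiped_a a x 1, ‖anisoMaximal a f y‖ₑ ∂(weightMeasure w)
      ≤ ∫⁻ y in parallelepiped_a a x 1, (anisoMaximal a f y ^ p + 1) ∂(weightMeasure w) := by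
        refine lintegral_mono fun y => ?_
        rw [enorm_eq_self]
        rcases le_total (anisoMaximal a f y) 1 with h | h
        · exact le_add_left h
        · refine le_add_right ?_
          conv_lhs => rw [← ENNReal.rpow_one (anisoMaximal a f y)]
          exact ENNReal.rpow_le_rpow_of_exponent_le h hp.le
    _ = ∫⁻ y in parallelepiped_a a x 1, anisoMaximal a f y ^ p ∂(weightMeasure w) +
        weightMeasure w (parallelepiped_a a x 1) := by
        rw [lintegral_add_right _ measurable_const, setLIntegral_const, one_mul]
    _ < ∞ := by
        refine ENNReal.add_lt_top.2 ⟨(hbound f hf x 1 one_pos).trans_lt ?_, hmtop.lt_top⟩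
        have := hf.2.ne
        have h2 : C * (weightMeasure w (parallelepiped_a a x 1) ^ κ * morreyNorm a p κ w f ^ p) ≠ ∞ := by
          finiteness
        exact h2.lt_top

/-- The weak type estimate for `A_1` weights on the weighted anisotropic Morrey space. -/
theorem MuckenhouptA1.exists_weak_morrey {β : Type*} [NormedAddCommGroup β]
    (ha : ∀ i, 0 < a i) {κ : ℝ} (hκ0 : 0 ≤ κ) (hκ1 : κ ≤ 1)
    {w : (Fin n → ℝ) → ℝ} (hA1 : MuckenhouptA1 a w) :
    ∃ C : ℝ, 0 < C ∧ ∀ f : (Fin n → ℝ) → β, MemMorrey a 1 κ w f →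
      ∀ (x : Fin n → ℝ) (r : ℝ), 0 < r → ∀ t : ℝ, 0 < t →
        weightMeasure w {y ∈ parallelepiped_a a x r | ENNReal.ofReal t < anisoMaximal a f y} ≤
          ENNReal.ofReal (C / t) * morreyNorm a 1 κ w f *
            weightMeasure w (parallelepiped_a a x r) ^ κ := by
  have hw : IsWeight w := hA1.1
  obtain ⟨A, hA, hAB⟩ := hA1.averageBound ha
  have hμ := hAB.isDoublingOnParallelepipeds ha one_pos hA
    (fun x _ ht => hw.weightMeasure_ne_zero x ht) (fun x t _ => hw.weightMeasure_ne_top x t)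
  obtain ⟨W, hW, hweak⟩ := hμ.weak_type ha
  obtain ⟨K, hK1, D, hD, hmax⟩ := maximalOperator_le_max_of_mem ha
  obtain ⟨D', hD', hdoub⟩ := hμ.doubling K hK1
  set C := W * A * D' ^ κ + D * A with hCdef
  have hC : C ≠ ∞ := by finiteness
  have hCle : C ≤ ENNReal.ofReal (C.toReal + 1) := by
    conv_lhs => rw [← ENNReal.ofReal_toReal hC]
    exact ENNReal.ofReal_le_ofReal (by linarith)
  refine ⟨C.toReal + 1, by positivity, fun f hf x r hr t ht => ?_⟩
  have hfm := hf.aemeasurable_enorm hw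
  set μ := weightMeasure w with hμdef
  set N := morreyNorm a 1 κ w f with hN
  set B := A * (μ (parallelepiped_a a x r) ^ (κ - 1) * N) with hB
  have hpt := hmax (fun y => ‖f y‖ₑ) x r hr B fun s hs => by
    simpa using hAB.average_le_morreyNorm ha one_pos hw hκ1 f hfm x hr hs
  have hloc := setLIntegral_indicator_parallelepiped_le (a := a) one_pos hw hκ0 (by linarith) hdoub
    f x hr
  simp only [ENNReal.rpow_one, ← hN] at hloc
  have hm0 := hμ.ne_zero x r hr
  have hmtop := hμ.ne_top x r hr
  have hfm' : AEMeasurable ((parallelepiped_a a x (K * r)).indicator fun y => ‖f y‖ₑ) volume :=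
    hfm.indicator (measurableSet_parallelepiped_a a x _)
  set E := parallelepiped_a a x r
  set g := (parallelepiped_a a x (K * r)).indicator fun y => ‖f y‖ₑ
  set c := ENNReal.ofReal t with hc
  have hc0 : c ≠ 0 := by simpa [hc] using ht
  have hctop : c ≠ ∞ := ENNReal.ofReal_ne_top
  -- At p = 1 the averaging inequality is itself a pointwise comparison of maximal operators.
  have hdom : ∀ y, maximalOperator a volume g y ≤ maximalOperator a μ (fun z => A * g z) y := by
    refine fun y => iSup₂_le fun s hs => ?_
    refine le_trans ?_ (average_le_maximalOperator _ y hs)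
    have := hAB g hfm' y s hs
    simp only [ENNReal.rpow_one, div_one] at this
    rwa [lintegral_const_mul' _ _ hA, mul_left_comm]
  have hmain : c * μ {y ∈ E | c < anisoMaximal a f y} ≤ C * (N * μ E ^ κ) := by
    -- Below the threshold D B the trivial bound μ(E) suffices; above it the large radii cannot
    -- exceed c, so the local part must.
    rcases lt_or_ge c (D * B) with hlt | hge
    · calc c * μ {y ∈ E | c < anisoMaximal a f y} ≤ D * B * μ E := by
            gcongr
            exact fun y hy => hy.1
        _ = D * A * (N * μ E ^ κ) * ((μ E)⁻¹ * μ E) := by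
            rw [hB, ENNReal.rpow_sub _ _ hm0 hmtop, ENNReal.rpow_one, div_eq_mul_inv]; ring
        _ ≤ C * (N * μ E ^ κ) := by
            rw [ENNReal.inv_mul_cancel hm0 hmtop, mul_one]
            gcongr
            exact le_add_self
    · calc c * μ {y ∈ E | c < anisoMaximal a f y}
          ≤ c * μ {y | c < maximalOperator a μ (fun z => A * g z) y} := by
            refine mul_le_mul' le_rfl (measure_mono ?_)
            rintro y ⟨hyE, hy⟩
            rcases lt_max_iff.1 (hy.trans_le (hpt y hyE)) with h | h
            · exact h.trans_le (hdom y)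
            · exact absurd h hge.not_gt
        _ ≤ W * ∫⁻ y, A * g y ∂μ := hweak _ c
        _ = W * A * ∫⁻ y, g y ∂μ := by rw [lintegral_const_mul' _ _ hA, mul_assoc]
        _ ≤ W * A * (D' ^ κ * (μ E ^ κ * N)) := mul_le_mul' le_rfl hloc
        _ = W * A * D' ^ κ * (N * μ E ^ κ) := by ring
        _ ≤ C * (N * μ E ^ κ) := by
            gcongr
            exact le_self_add
  calc μ {y ∈ E | c < anisoMaximal a f y}
      = c⁻¹ * (c * μ {y ∈ E | c < anisoMaximal a f y}) := by
        rw [← mul_assoc, ENNReal.inv_mul_cancel hc0 hctop, one_mul]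
    _ ≤ c⁻¹ * (ENNReal.ofReal (C.toReal + 1) * (N * μ E ^ κ)) := by
        exact mul_le_mul' le_rfl (hmain.trans (mul_le_mul' hCle le_rfl))
    _ = _ := by
        rw [ENNReal.ofReal_div_of_pos ht, div_eq_mul_inv]; ring

end Morrey

theorem theorem3 {𝕜 : Type*} [RCLike 𝕜] {n : ℕ} (a : Fin n → ℝ) (ha : ∀ i, 0 < a i)
    (κ : ℝ) (hκ0 : 0 < κ) (hκ1 : κ < 1) (w : (Fin n → ℝ) → ℝ) :
    (∀ p : ℝ, 1 < p → MuckenhouptAp a p w →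
      ∃ C : ℝ, 0 < C ∧ ∀ f : (Fin n → ℝ) → 𝕜, MemMorrey a p κ w f →
        MemMorrey a p κ w (anisoMaximal a f) ∧
        morreyNorm a p κ w (anisoMaximal a f) ≤ ENNReal.ofReal C * morreyNorm a p κ w f) ∧
    (MuckenhouptA1 a w →
      ∃ C : ℝ, 0 < C ∧ ∀ f : (Fin n → ℝ) → 𝕜, MemMorrey a 1 κ w f →
        ∀ (x₀ : Fin n → ℝ) (r : ℝ), 0 < r → ∀ t : ℝ, 0 < t →
          weightMeasure w {x ∈ parallelepiped_a a x₀ r | ENNReal.ofReal t < anisoMaximal a f x} ≤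
            ENNReal.ofReal (C / t) * morreyNorm a 1 κ w f *
              weightMeasure w (parallelepiped_a a x₀ r) ^ κ) :=
  ⟨fun _ hp hAp => hAp.exists_morreyNorm_anisoMaximal_le ha hp hκ0.le hκ1.le,
    fun hA1 => hA1.exists_weak_morrey ha hκ0.le hκ1.le⟩
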